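/- Let $N\ge 1$ and let $A=[a_{i,j}]$ be an $N\times N$ matrix with entries in $\{0,1\}$. Let $\Sigma=\Sigma(A)=\{x\in\{1,\dots,N\}^{\mathbb Z} : a_{x_i,x_{i+1}}=1 \text{ for all } i\in\mathbb Z\}$, with the $\sigma$-algebra generated by the cylinders $C([\alpha;i_1,\dots,i_n])=\{x\in\Sigma : x_\alpha=i_1,\dots,x_{\alpha+n-1}=i_n\}$ and with the shift $(\sigma x)_i=x_{i+1}$. Let $\mathcal B_n$ be the set of words $[i_1,\dots,i_n]$ with $C([\alpha;i_1,\dots,i_n])\neq\emptyset$ for some $\alpha$, and let $C_{k,l}([i_1,\dots,i_n])$ be the set of words $(x_{-k+1},\dots,x_{n+l})\in\mathcal B_{n+k+l}$ with $x_j=i_j$ for $1\le j\le n$. The matrix $A$ is irreducible if for all $i,j$ there is $m\ge 1$ with $(A^m)_{i,j}>0$; it is irreducible and aperiodic (primitive) if some $m\geq 1$ has $(A^m)_{i,j}>0$ for all $i,j$; an irreducible $A$ has period $p$ if $\gcd\{m\ge 1 : (A^m)_{i,i}>0\}=p$ for every $i$. The Perron value $\lambda$ of $A$ is the nonnegative eigenvalue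 such that no complex eigenvalue of $A$ has a larger absolute value. A Parry measure of $\Sigma$ is a probability measure $m$ on $\Sigma$ with $$m(C([\alpha;i_1,\dots,i_n]))=\frac{u_{i_1}v_{i_n}}{\lambda^{n-1}}\,a_{i_1,i_2}\cdots a_{i_{n-1},i_n}\qquad(n\ge 1,\ \alpha\in\mathbb Z,\ 1\le i_1,\dots,i_n\le N),$$ where $\lambda$ is the Perron value and $U=(u_i)$, $V=(v_i)$ are a left and a right eigenvector of $A$ for $\lambda$ with $UV=\sum_i u_iv_i=1$ (such $U,V$ are required to exist, and the formula is required for every such choice). (1) If $A$ is irreducible and aperiodic, then there is a unique probability measure $\mu$ on $\Sigma$, the natural measure, such that for all $n\ge 1$, all $\alpha$ and all $i_1,\dots,i_n$ the following limit exists and $$\mu(C([\alpha;i_1,\dots,i_n]))=\lim_{k,l\to\infty}\frac{|C_{k,l}([i_1,\dots,i_n])|}{|\mathcal B_{n+k+l}|}.$$ (2) If $A$ is irreducible with period $p\ge 2$, then there is a unique probability measure $\mu$ on $\Sigma$, the natural measure, such that for all $n\ge 1$, all $\alpha$ and all $i_1,\dots,i_n$ the following limit exists and $$\mu(C([\alpha;i_1,\dots,i_n]))=\lim_{k,l\to\infty}\frac1p\sum_{j=0}^{p-1}\frac{|C_{k-j,l+j}([i_1,\dots,i_n])|}{|\mathcal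 B_{n+k+l}|}.$$ In both cases $\mu$ is the Parry measure, that is, $\mu$ is a Parry measure and there is no other. In both cases, moreover, $\mu$ is the only probability measure on $\Sigma$ that is ergodic for $\sigma$ and has maximal entropy, that is, whose measure-theoretic entropy $h_\mu(\sigma)$ equals the topological entropy $h(\Sigma)=\lim_{n\to\infty}\frac1n\log|\mathcal B_n|$. -/

import Mathlib

open Filter MeasureTheory Topology

noncomputable section

namespace ShiftSpace

/-! ### Shifts of finite type, words and cylinders

Bi-infinite sequences over the alphabet `Fin N` are functions `ℤ → Fin N`. The alphabet is discrete
and `ℤ → Fin N` carries the product sigma-algebra, which is the one generated by the cylinders.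
-/

/-- The two-sided shift of finite type of a 0-1 matrix `A`, as a set of sequences. -/
def sft {N : ℕ} (A : Matrix (Fin N) (Fin N) ℝ) : Set (ℤ → Fin N) :=
  {x | ∀ i : ℤ, A (x i) (x (i + 1)) = 1}

/-- The left shift `(σ x) i = x (i + 1)` on the shift of finite type of `A`. -/
def shift {N : ℕ} (A : Matrix (Fin N) (Fin N) ℝ) (x : sft A) : sft A :=
  ⟨fun i => x.1 (i + 1), fun i => x.2 (i + 1)⟩

/-- The cylinder of the sequences in `X` which carry the word `w` at the sites
`α, α + 1, …, α + n - 1`. -/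
def cylinder {N : ℕ} (X : Set (ℤ → Fin N)) {n : ℕ} (α : ℤ) (w : Fin n → Fin N) : Set X :=
  {x | ∀ j : Fin n, x.1 (α + (j : ℕ)) = w j}

/-- The set of admissible words of length `n` of `X`: those with a nonempty cylinder. -/
def words {N : ℕ} (X : Set (ℤ → Fin N)) (n : ℕ) : Set (Fin n → Fin N) :=
  {w | ∃ α : ℤ, (cylinder X α w).Nonempty}

/-- The finite cylinder `C_{k,l}(w)`: the admissible words of length `n + k + l` that carry the
word `w` of length `n` after their first `k` letters. (The letters with indices
`-k + 1, …, n + l` are numbered here from `0` to `n + k + l - 1`.) -/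
def finiteCylinder {N : ℕ} (X : Set (ℤ → Fin N)) {n : ℕ} (k l : ℕ) (w : Fin n → Fin N) :
    Set (Fin (n + k + l) → Fin N) :=
  {x | x ∈ words X (n + k + l) ∧ ∀ j : Fin n, x ⟨k + (j : ℕ), by omega⟩ = w j}

/-! ### Natural measures -/

/-- `μ` is the natural measure of `X`: a probability measure such that for every word `w` of length
`n ≥ 1` the limit of `|C_{k,l}(w)| / |B_{n+k+l}|` as `k, l → ∞` exists and is the measure of the
cylinders of `w`. On `ℕ × ℕ`, `atTop` says that both coordinates tend to infinity, independently of
each other. -/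
def IsNaturalMeasure {N : ℕ} (X : Set (ℤ → Fin N)) (μ : Measure X) : Prop :=
  IsProbabilityMeasure μ ∧
  ∀ (n : ℕ), 1 ≤ n → ∀ (w : Fin n → Fin N) (α : ℤ),
    Tendsto
      (fun q : ℕ × ℕ =>
        ((finiteCylinder X q.1 q.2 w).ncard : ℝ) / ((words X (n + q.1 + q.2)).ncard : ℝ))
      atTop (𝓝 (μ.real (cylinder X α w)))

/-- `μ` is the natural measure of `X` obtained by averaging over `p` successive positions: a
probability measure such that for every word `w` of length `n ≥ 1` the limit of
`(1 / p) ∑_{j < p} |C_{k-j,l+j}(w)| / |B_{n+k+l}|` as `k, l → ∞` exists and is the measure of the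
cylinders of `w`. (The truncated difference `k - j` is the true one as soon as `k ≥ p`.) -/
def IsAveragedNaturalMeasure {N : ℕ} (X : Set (ℤ → Fin N)) (p : ℕ) (μ : Measure X) : Prop :=
  IsProbabilityMeasure μ ∧
  ∀ (n : ℕ), 1 ≤ n → ∀ (w : Fin n → Fin N) (α : ℤ),
    Tendsto
      (fun q : ℕ × ℕ =>
        (1 / (p : ℝ)) * ∑ j ∈ Finset.range p,
          ((finiteCylinder X (q.1 - j) (q.2 + j) w).ncard : ℝ) /
            ((words X (n + q.1 + q.2)).ncard : ℝ))
      atTop (𝓝 (μ.real (cylinder X α w)))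

/-! ### Period, Perron value, Parry measure -/

/-- `A` has period `p`: for every index `i`, `p` is the greatest common divisor of all `n ≥ 1` with
`(A ^ n) i i > 0`. -/
def HasPeriod {N : ℕ} (A : Matrix (Fin N) (Fin N) ℝ) (p : ℕ) : Prop :=
  ∀ i : Fin N, Nat.setGcd {n : ℕ | 1 ≤ n ∧ 0 < (A ^ n) i i} = p

/-- `lam` is the Perron value of `A`: a nonnegative eigenvalue such that no complex eigenvalue of
`A` has a larger absolute value. -/
def IsPerronValue {N : ℕ} (A : Matrix (Fin N) (Fin N) ℝ) (lam : ℝ) : Prop :=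
  0 ≤ lam ∧ Module.End.HasEigenvalue (Matrix.toLin' A) lam ∧
  ∀ z : ℂ, Module.End.HasEigenvalue (Matrix.toLin' (A.map Complex.ofReal)) z → ‖z‖ ≤ lam

/-- `lam` is the Perron value of `A`, and `U`, `V` are a left and a right eigenvector for it,
normalized by `U V = 1`. -/
def IsPerronTriple {N : ℕ} (A : Matrix (Fin N) (Fin N) ℝ) (lam : ℝ) (U V : Fin N → ℝ) : Prop :=
  IsPerronValue A lam ∧ Matrix.vecMul U A = lam • U ∧ Matrix.mulVec A V = lam • V ∧
  dotProduct U V = 1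

/-- `μ` is the Parry measure of the shift of finite type of `A`: the probability measure that gives
the cylinders of every word `w = [w 0, …, w n]` the mass
`U (w 0) V (w n) / lam ^ n * ∏ A (w i) (w (i + 1))`. A normalized triple has to exist, and the
formula has to hold for each one. -/
def IsParryMeasure {N : ℕ} (A : Matrix (Fin N) (Fin N) ℝ) (μ : Measure (sft A)) : Prop :=
  IsProbabilityMeasure μ ∧
  (∃ (lam : ℝ) (U V : Fin N → ℝ), IsPerronTriple A lam U V) ∧
  ∀ (lam : ℝ) (U V : Fin N → ℝ), IsPerronTriple A lam U V →
    ∀ (n : ℕ) (w : Fin (n + 1) → Fin N) (α : ℤ),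
      μ.real (cylinder (sft A) α w) =
        U (w 0) * V (w (Fin.last n)) / lam ^ n * ∏ i : Fin n, A (w i.castSucc) (w i.succ)

/-! ### Entropy

Entropies are extended reals. The limits in both definitions exist (by subadditivity, in the case
of a measure for an invariant one), so that they are expressed by the limit superior.
-/

/-- The entropy `- ∑ m(B) log m(B)` of the join of `T^{-i} ξ`, `0 ≤ i < n`, where `ξ` is the finite
measurable partition into the fibres of `f : X → Fin k`. The atoms of the join are the fibres of
`x ↦ (f x, f (T x), …, f (T^{n-1} x))`; empty atoms contribute `0`. -/
def joinEntropy {X : Type*} [MeasurableSpace X] (T : X → X) (m : Measure X) {k : ℕ}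
    (f : X → Fin k) (n : ℕ) : ℝ :=
  ∑ a : Fin n → Fin k, Real.negMulLog (m.real {x | ∀ i : Fin n, f (T^[(i : ℕ)] x) = a i})

/-- The measure-theoretic entropy of `T` with respect to `m`: the supremum over all finite
measurable partitions of the entropy of `T` with respect to the partition. -/
def measureEntropy {X : Type*} [MeasurableSpace X] (T : X → X) (m : Measure X) : EReal :=
  ⨆ (k : ℕ) (f : X → Fin k) (_ : Measurable f),
    limsup (fun n : ℕ => ((joinEntropy T m f n / (n : ℝ) : ℝ) : EReal)) atTop

/-- The topological entropy of `X`: the growth rate of the number of admissible words. -/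
def topEntropy {N : ℕ} (X : Set (ℤ → Fin N)) : EReal :=
  limsup (fun n : ℕ => ((Real.log ((words X n).ncard : ℝ) / (n : ℝ) : ℝ) : EReal)) atTop

/-- `μ` is a probability measure on the shift of finite type of `A` which is ergodic (in particular
invariant) for the shift and has maximal entropy. -/
def IsErgodicOfMaximalEntropy {N : ℕ} (A : Matrix (Fin N) (Fin N) ℝ) (μ : Measure (sft A)) :
    Prop :=
  IsProbabilityMeasure μ ∧ Ergodic (shift A) μ ∧ measureEntropy (shift A) μ = topEntropy (sft A)

end ShiftSpace

end

noncomputable section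

namespace ShiftSpace

set_option linter.unusedSectionVars false

/-! ### Entropy of functions with finitely many values -/

section FiniteEntropy

open Real

/-! Let `t` be the Perron value of an irreducible `A`, with positive left and right eigenvectors
`u`, `v` and `u ⬝ᵥ v = 1`. The Parry measure is the stationary Markov chain with transition matrix
`P i j = A i j * v j / (t * v i)` and initial law `u i * v i`. Its word weights are consistent, so a
weak limit of finitely supported measures realises them (`IsPositiveEigenTriple.exists_measure`).
Each of the three characterizations is proved by comparison with this measure.

Entropy: for an invariant `ν`, Gibbs' inequality compares the masses of the words of length `n + 2`
with the masses obtained by continuing words of length `n + 1` according to `P`. The entropy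
increment is therefore at most `log t`, with equality only if `ν` itself continues by `P`.
Increments are nonincreasing by strong subadditivity, so one increment below `log t` forces a
smaller growth rate for ever. If no increment is below `log t`, then `ν` is Markov with matrix `P`,
hence Parry, because left eigenvectors for `t` are unique up to scaling
(`exists_lt_fibreEntropy_le`). `measureEntropy_le` carries the bound from the partition by one
letter to all finite partitions. The Parry measure reaches `log t`, since its words of length `n +
1` have mass at most a constant times `t ^ (-n)`. It is ergodic, since otherwise it would be a
mixture of two invariant measures of smaller growth rate.

Counting: the number of words carrying `w` after `k` letters and before `l` letters factors into row
sums of powers of `Aᵀ` and `A`. Since `P` contracts oscillations inside each cyclic class, `rowSum A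
k i / t ^ k` is asymptotic to `p * v i` times the `u`-mass of the class reached from `i` in `k`
steps (`IsPositiveEigenTriple.tendsto_rowSum`). For `p ≥ 2` this may oscillate in `k`, but `p`
consecutive positions run through all classes once, so the average converges
(`IsPositiveEigenTriple.tendsto_average`). The primitive case is `p = 1`. -/

theorem negMulLog_add_le {x y : ℝ} (hx : 0 ≤ x) (hy : 0 ≤ y) :
    negMulLog (x + y) ≤ negMulLog x + negMulLog y := by
  rcases hx.eq_or_lt with rfl | hx
  · simp
  rcases hy.eq_or_lt with rfl | hy
  · simp
  have h1 : log x ≤ log (x + y) := log_le_log hx (by linarith)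
  have h2 : log y ≤ log (x + y) := log_le_log hy (by linarith)
  simp only [negMulLog]
  nlinarith

theorem negMulLog_sum_le {ι : Type*} (s : Finset ι) (p : ι → ℝ) (hp : ∀ i, 0 ≤ p i) :
    negMulLog (∑ i ∈ s, p i) ≤ ∑ i ∈ s, negMulLog (p i) := by
  classical
  induction s using Finset.induction_on with
  | empty => simp
  | insert a s ha ih =>
    rw [Finset.sum_insert ha, Finset.sum_insert ha]
    exact (negMulLog_add_le (hp a) (Finset.sum_nonneg fun i _ => hp i)).trans (by gcongr)

/-- The pointwise estimate behind Gibbs' inequality. -/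
theorem negMulLog_add_mul_log_le {p q : ℝ} (hp : 0 ≤ p) (hq : 0 ≤ q) (h : q = 0 → p = 0) :
    negMulLog p + p * log q ≤ q - p := by
  rcases hp.eq_or_lt with rfl | hp
  · simpa
  have hq : 0 < q := hq.lt_of_ne fun h' => hp.ne' (h h'.symm)
  have h1 := log_le_sub_one_of_pos (div_pos hq hp)
  rw [log_div hq.ne' hp.ne'] at h1
  have h2 := mul_le_mul_of_nonneg_left h1 hp.le
  have h3 : p * (q / p - 1) = q - p := by field_simp
  simp only [negMulLog]
  linarith

theorem negMulLog_add_mul_log_lt {p q : ℝ} (hp : 0 ≤ p) (hq : 0 ≤ q) (h : q = 0 → p = 0)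
    (hne : p ≠ q) : negMulLog p + p * log q < q - p := by
  rcases hp.eq_or_lt with rfl | hp
  · simpa using hq.lt_of_ne hne
  have hq : 0 < q := hq.lt_of_ne fun h' => hp.ne' (h h'.symm)
  have h1 := log_lt_sub_one_of_pos (div_pos hq hp) (by
    rw [Ne, div_eq_one_iff_eq hp.ne']; exact hne.symm)
  rw [log_div hq.ne' hp.ne'] at h1
  have h2 := mul_lt_mul_of_pos_left h1 hp
  have h3 : p * (q / p - 1) = q - p := by field_simp
  simp only [negMulLog]
  linarith

/-- Gibbs' inequality. -/
theorem sum_negMulLog_le {ι : Type*} [Fintype ι] (p q : ι → ℝ) (hp : ∀ i, 0 ≤ p i)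
    (hq : ∀ i, 0 ≤ q i) (h : ∀ i, q i = 0 → p i = 0) (hs : ∑ i, q i ≤ ∑ i, p i) :
    ∑ i, negMulLog (p i) ≤ - ∑ i, p i * log (q i) := by
  have := Finset.sum_le_sum fun i (_ : i ∈ Finset.univ) =>
    negMulLog_add_mul_log_le (hp i) (hq i) (h i)
  rw [Finset.sum_add_distrib, Finset.sum_sub_distrib] at this
  linarith

/-- The strict case of Gibbs' inequality. -/
theorem sum_negMulLog_lt {ι : Type*} [Fintype ι] (p q : ι → ℝ) (hp : ∀ i, 0 ≤ p i)
    (hq : ∀ i, 0 ≤ q i) (h : ∀ i, q i = 0 → p i = 0) (hs : ∑ i, q i ≤ ∑ i, p i) (hne : p ≠ q) :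
    ∑ i, negMulLog (p i) < - ∑ i, p i * log (q i) := by
  obtain ⟨j, hj⟩ := Function.ne_iff.1 hne
  have := Finset.sum_lt_sum (fun i (_ : i ∈ Finset.univ) =>
    negMulLog_add_mul_log_le (hp i) (hq i) (h i))
    ⟨j, Finset.mem_univ j, negMulLog_add_mul_log_lt (hp j) (hq j) (h j) hj⟩
  rw [Finset.sum_add_distrib, Finset.sum_sub_distrib] at this
  linarith

/-- Subadditivity of the entropy of a finite array of nonnegative numbers. -/
theorem sum_negMulLog_add_le {α γ : Type*} [Fintype α] [Fintype γ] (p : α → γ → ℝ)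
    (hp : ∀ a c, 0 ≤ p a c) :
    ∑ a, ∑ c, negMulLog (p a c) + negMulLog (∑ a, ∑ c, p a c) ≤
      ∑ a, negMulLog (∑ c, p a c) + ∑ c, negMulLog (∑ a, p a c) := by
  set r : α → ℝ := fun a => ∑ c, p a c with hr
  set s : γ → ℝ := fun c => ∑ a, p a c with hs
  set t : ℝ := ∑ a, ∑ c, p a c with ht
  have hr0 : ∀ a, 0 ≤ r a := fun a => Finset.sum_nonneg fun c _ => hp a c
  have hs0 : ∀ c, 0 ≤ s c := fun c => Finset.sum_nonneg fun a _ => hp a c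
  have hpr : ∀ a c, p a c ≤ r a := fun a c =>
    Finset.single_le_sum (f := fun c => p a c) (fun c _ => hp a c) (Finset.mem_univ c)
  have hps : ∀ a c, p a c ≤ s c := fun a c =>
    Finset.single_le_sum (f := fun a => p a c) (fun a _ => hp a c) (Finset.mem_univ a)
  have hrt : ∀ a, r a ≤ t := fun a =>
    Finset.single_le_sum (f := r) (fun a _ => hr0 a) (Finset.mem_univ a)
  have ht' : ∑ c, s c = t := Finset.sum_comm
  -- Gibbs' estimate against the product array `r a * s c / t`, which has the same total `t`. Zero
  -- entries are treated apart because the logarithm of the product cannot be split there.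
  have key : ∀ a c, negMulLog (p a c) + (p a c * log (r a) + p a c * log (s c)
      - p a c * log t) ≤ r a * s c / t - p a c := by
    intro a c
    rcases (hp a c).eq_or_lt with h0 | h0
    · rw [← h0]
      have : 0 ≤ r a * s c / t :=
        div_nonneg (mul_nonneg (hr0 a) (hs0 c)) ((hr0 a).trans (hrt a))
      simpa
    have h1 : 0 < r a := h0.trans_le (hpr a c)
    have h2 : 0 < s c := h0.trans_le (hps a c)
    have h3 : 0 < t := h1.trans_le (hrt a)
    have := negMulLog_add_mul_log_le (hp a c) (q := r a * s c / t) (by positivity)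
      (fun h => absurd h (by positivity))
    rw [log_div (by positivity) h3.ne', log_mul h1.ne' h2.ne'] at this
    linarith
  have hsum := Finset.sum_le_sum fun a (_ : a ∈ Finset.univ) =>
    Finset.sum_le_sum fun c (_ : c ∈ Finset.univ) => key a c
  simp only [Finset.sum_add_distrib, Finset.sum_sub_distrib] at hsum
  have e1 : ∑ a, ∑ c, p a c * log (r a) = ∑ a, r a * log (r a) :=
    Finset.sum_congr rfl fun a _ => by rw [← Finset.sum_mul]
  have e2 : ∑ a, ∑ c, p a c * log (s c) = ∑ c, s c * log (s c) := by
    rw [Finset.sum_comm]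
    exact Finset.sum_congr rfl fun a _ => by rw [← Finset.sum_mul]
  have e3 : ∑ a, ∑ c, p a c * log t = t * log t := by
    rw [ht, Finset.sum_mul]
    exact Finset.sum_congr rfl fun a _ => by rw [← Finset.sum_mul]
  have e4 : ∑ a, ∑ c, r a * s c / t = t := by
    simp_rw [mul_div_assoc, ← Finset.mul_sum, ← Finset.sum_mul, ← Finset.sum_div, ht']
    change t * (t / t) = t
    rcases eq_or_ne t 0 with h | h
    · simp [h]
    · field_simp
  rw [e1, e2, e3, e4] at hsum
  simp only [negMulLog, neg_mul, Finset.sum_neg_distrib] at hsum ⊢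
  linarith

end FiniteEntropy

/-- The entropy of the partition into the fibres of a function with finitely many values. -/
def fibreEntropy {X α : Type*} [MeasurableSpace X] [Fintype α] (m : Measure X) (F : X → α) : ℝ :=
  ∑ a, Real.negMulLog (m.real (F ⁻¹' {a}))

/-! ### Coarsening, invariance and strong subadditivity of the entropy of a partition. -/

section FibreEntropy

variable {X α β γ : Type*} [MeasurableSpace X] {m : Measure X} [IsFiniteMeasure m]
  [Fintype α] [MeasurableSpace α] [MeasurableSingletonClass α]
  [Fintype β] [MeasurableSpace β] [MeasurableSingletonClass β]
  [Fintype γ] [MeasurableSpace γ] [MeasurableSingletonClass γ]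

theorem measureReal_fibre_comp [DecidableEq β] {F : X → α} (hF : Measurable F) (φ : α → β)
    (b : β) :
    m.real ((φ ∘ F) ⁻¹' {b}) = ∑ a with φ a = b, m.real (F ⁻¹' {a}) := by
  rw [sum_measureReal_preimage_singleton _ fun a _ => hF (measurableSet_singleton a)]
  congr 1
  ext x
  simp

theorem sum_measureReal_fibre_comp_mul {F : X → α} (hF : Measurable F) (φ : α → β) (g : β → ℝ) :
    ∑ a, m.real (F ⁻¹' {a}) * g (φ a) = ∑ b, m.real ((φ ∘ F) ⁻¹' {b}) * g b := by
  classical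
  simp_rw [measureReal_fibre_comp hF, Finset.sum_mul, Finset.sum_filter]
  rw [Finset.sum_comm]
  exact Finset.sum_congr rfl fun a _ => by simp

theorem sum_measureReal_fibre {F : X → α} (hF : Measurable F) :
    ∑ a, m.real (F ⁻¹' {a}) = m.real Set.univ := by
  rw [sum_measureReal_preimage_singleton _ fun a _ => hF (measurableSet_singleton a)]
  simp

/-- Coarsening a partition does not increase the entropy. -/
theorem fibreEntropy_comp_le {F : X → α} (hF : Measurable F) (φ : α → β) :
    fibreEntropy m (φ ∘ F) ≤ fibreEntropy m F := by
  classical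
  unfold fibreEntropy
  simp_rw [measureReal_fibre_comp hF]
  calc _ ≤ ∑ b, ∑ a with φ a = b, Real.negMulLog (m.real (F ⁻¹' {a})) :=
        Finset.sum_le_sum fun b _ => negMulLog_sum_le _ _ fun a => measureReal_nonneg
    _ = _ := by
        simp_rw [Finset.sum_filter]
        rw [Finset.sum_comm]
        exact Finset.sum_congr rfl fun a _ => by simp

/-- Two functions that determine each other have the same entropy. -/
theorem fibreEntropy_congr {F : X → α} {G : X → β} (hF : Measurable F) (hG : Measurable G)
    (φ : α → β) (ψ : β → α) (h1 : G = φ ∘ F) (h2 : F = ψ ∘ G) :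
    fibreEntropy m F = fibreEntropy m G := by
  apply le_antisymm
  · conv_lhs => rw [h2]
    exact fibreEntropy_comp_le hG ψ
  · conv_lhs => rw [h1]
    exact fibreEntropy_comp_le hF φ

theorem fibreEntropy_comp_measurePreserving {T : X → X} (hT : MeasurePreserving T m m)
    {F : X → α} (hF : Measurable F) : fibreEntropy m (F ∘ T) = fibreEntropy m F := by
  unfold fibreEntropy
  refine Finset.sum_congr rfl fun a _ => ?_
  rw [Set.preimage_comp, hT.measureReal_preimage (hF (measurableSet_singleton a)).nullMeasurableSet]

/-- Strong subadditivity of the entropy. -/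
theorem fibreEntropy_strong_subadditive {F : X → α} {G : X → β} {K : X → γ} (hF : Measurable F)
    (hG : Measurable G) (hK : Measurable K) :
    fibreEntropy m (fun x => (F x, G x, K x)) + fibreEntropy m G ≤
      fibreEntropy m (fun x => (F x, G x)) + fibreEntropy m (fun x => (G x, K x)) := by
  classical
  have hJ : Measurable fun x => (F x, G x, K x) := hF.prodMk (hG.prodMk hK)
  set p : β → α → γ → ℝ := fun b a c => m.real ((fun x => (F x, G x, K x)) ⁻¹' {(a, b, c)}) with hp
  have e1 : fibreEntropy m (fun x => (F x, G x, K x)) =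
      ∑ b, ∑ a, ∑ c, Real.negMulLog (p b a c) := by
    unfold fibreEntropy
    simp_rw [Fintype.sum_prod_type]
    rw [Finset.sum_comm]
  have eG : ∀ b, m.real (G ⁻¹' {b}) = ∑ a, ∑ c, p b a c := by
    intro b
    have := measureReal_fibre_comp (m := m) hJ (fun t => t.2.1) b
    rw [show (fun t : α × β × γ => t.2.1) ∘ (fun x => (F x, G x, K x)) = G from rfl] at this
    rw [this, Finset.sum_filter, Fintype.sum_prod_type]
    refine Finset.sum_congr rfl fun a _ => ?_
    rw [Fintype.sum_prod_type, Finset.sum_eq_single b]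
    · simp [hp]
    · intro b' _ hb; simp [hb]
    · simp
  have eFG : ∀ a b, m.real ((fun x => (F x, G x)) ⁻¹' {(a, b)}) = ∑ c, p b a c := by
    intro a b
    have := measureReal_fibre_comp (m := m) hJ (fun t => (t.1, t.2.1)) (a, b)
    rw [show (fun t : α × β × γ => (t.1, t.2.1)) ∘ (fun x => (F x, G x, K x)) =
      fun x => (F x, G x) from rfl] at this
    rw [this, Finset.sum_filter, Fintype.sum_prod_type, Finset.sum_eq_single a]
    · rw [Fintype.sum_prod_type, Finset.sum_eq_single b]
      · simp [hp]
      · intro b' _ hb; simp [hb]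
      · simp
    · intro a' _ ha; simp [ha]
    · simp
  have eGK : ∀ b c, m.real ((fun x => (G x, K x)) ⁻¹' {(b, c)}) = ∑ a, p b a c := by
    intro b c
    have := measureReal_fibre_comp (m := m) hJ (fun t => t.2) (b, c)
    rw [show (fun t : α × β × γ => t.2) ∘ (fun x => (F x, G x, K x)) =
      fun x => (G x, K x) from rfl] at this
    rw [this, Finset.sum_filter, Fintype.sum_prod_type]
    refine Finset.sum_congr rfl fun a _ => ?_
    simp [hp]
  have e2 : fibreEntropy m (fun x => (F x, G x)) = ∑ b, ∑ a, Real.negMulLog (∑ c, p b a c) := by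
    unfold fibreEntropy
    rw [Fintype.sum_prod_type, Finset.sum_comm]
    simp_rw [eFG]
  have e3 : fibreEntropy m (fun x => (G x, K x)) = ∑ b, ∑ c, Real.negMulLog (∑ a, p b a c) := by
    unfold fibreEntropy
    rw [Fintype.sum_prod_type]
    simp_rw [eGK]
  rw [e1, e2, e3]
  unfold fibreEntropy
  simp_rw [eG]
  rw [← Finset.sum_add_distrib, ← Finset.sum_add_distrib]
  -- For each fixed value `b` of `G` this is plain subadditivity for the array `p b`.
  exact Finset.sum_le_sum fun b _ => sum_negMulLog_add_le _ fun a c => measureReal_nonneg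

/-- Dropping a partition does not increase the entropy. -/
theorem fibreEntropy_le_prodMk {F : X → α} {G : X → β} (hF : Measurable F) (hG : Measurable G) :
    fibreEntropy m F ≤ fibreEntropy m (fun x => (F x, G x)) :=
  fibreEntropy_comp_le (hF.prodMk hG) Prod.fst

/-- The entropy of `F` under `m` is at most that under two measures adding up to `m`. -/
theorem fibreEntropy_le_add {m₁ m₂ : Measure X} (F : X → α)
    (h : ∀ a, m.real (F ⁻¹' {a}) = m₁.real (F ⁻¹' {a}) + m₂.real (F ⁻¹' {a})) :
    fibreEntropy m F ≤ fibreEntropy m₁ F + fibreEntropy m₂ F := by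
  unfold fibreEntropy
  rw [← Finset.sum_add_distrib]
  refine Finset.sum_le_sum fun a _ => ?_
  rw [h]
  exact negMulLog_add_le measureReal_nonneg measureReal_nonneg

end FibreEntropy

/-! ### Entropies of itineraries. -/

section Conditional

variable {X α β : Type*} [MeasurableSpace X] {m : Measure X} [IsFiniteMeasure m]
  [Fintype α] [MeasurableSpace α] [MeasurableSingletonClass α]
  [Fintype β] [MeasurableSpace β] [MeasurableSingletonClass β]

/-- The itinerary of length `n` of a point with respect to the partition into fibres of `f`. -/
def itinerary (T : X → X) (f : X → α) (n : ℕ) (x : X) : Fin n → α := fun i => f (T^[i] x)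

theorem measurable_itinerary {T : X → X} (hT : Measurable T) {f : X → α} (hf : Measurable f)
    (n : ℕ) : Measurable (itinerary T f n) :=
  measurable_pi_lambda _ fun i => hf.comp (hT.iterate i)

theorem joinEntropy_eq {k : ℕ} (T : X → X) (f : X → Fin k) (n : ℕ) :
    joinEntropy T m f n = fibreEntropy m (itinerary T f n) := by
  unfold joinEntropy fibreEntropy itinerary
  refine Finset.sum_congr rfl fun a _ => ?_
  congr 2
  ext x
  simp [funext_iff]

theorem itinerary_succ (T : X → X) (f : X → α) (n : ℕ) (x : X) :
    itinerary T f (n + 1) x = Fin.snoc (α := fun _ => α) (itinerary T f n x) (f (T^[n] x)) := by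
  ext i
  induction i using Fin.lastCases with
  | last => simp only [itinerary, Fin.snoc_last, Fin.val_last]
  | cast i => simp only [itinerary, Fin.snoc_castSucc, Fin.val_castSucc]

theorem itinerary_succ' (T : X → X) (f : X → α) (n : ℕ) (x : X) :
    itinerary T f (n + 1) x = Fin.cons (α := fun _ => α) (f x) (itinerary T f n (T x)) := by
  ext i
  induction i using Fin.cases with
  | zero => simp only [itinerary, Fin.cons_zero, Fin.val_zero, Function.iterate_zero, id_eq]
  | succ i => simp only [itinerary, Fin.cons_succ, Fin.val_succ, Function.iterate_succ_apply]

/-- In each step the new `f`-letter, given all the rest, costs at most its entropy given the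
simultaneous `g`-letter; the new `g`-letter, given both pasts, costs at most its entropy given the
`g`-past. These are the two uses `h1`, `h2` of strong subadditivity. -/
theorem fibreEntropy_itinerary_prod_le {T : X → X} (hT : MeasurePreserving T m m) {f : X → α}
    {g : X → β} (hf : Measurable f) (hg : Measurable g) (n : ℕ) :
    fibreEntropy m (fun x => (itinerary T f n x, itinerary T g n x)) ≤
      fibreEntropy m (itinerary T g n) +
        n * (fibreEntropy m (fun x => (f x, g x)) - fibreEntropy m g) := by
  have mF := measurable_itinerary hT.measurable hf
  have mG := measurable_itinerary hT.measurable hg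
  induction n with
  | zero =>
    simp only [Nat.cast_zero, zero_mul, add_zero]
    exact (fibreEntropy_congr ((mF 0).prodMk (mG 0)) (mG 0) Prod.snd (fun w => (Fin.elim0, w)) rfl
      (by ext x i; exacts [i.elim0, i.elim0])).le
  | succ n ih =>
    have mfn : Measurable fun x => f (T^[n] x) := hf.comp (hT.measurable.iterate n)
    have mgn : Measurable fun x => g (T^[n] x) := hg.comp (hT.measurable.iterate n)
    have h1 := fibreEntropy_strong_subadditive (m := m) mfn mgn ((mF n).prodMk (mG n))
    have h2 := fibreEntropy_strong_subadditive (m := m) (mF n) (mG n) mgn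
    have e1 : fibreEntropy m (fun x => (itinerary T f (n + 1) x, itinerary T g (n + 1) x)) =
        fibreEntropy m
          (fun x => (f (T^[n] x), g (T^[n] x), itinerary T f n x, itinerary T g n x)) :=
      fibreEntropy_congr ((mF _).prodMk (mG _)) (mfn.prodMk (mgn.prodMk ((mF n).prodMk (mG n))))
        (fun t => (t.1 (Fin.last n), t.2 (Fin.last n), Fin.init t.1, Fin.init t.2))
        (fun t => (Fin.snoc (α := fun _ => α) t.2.2.1 t.1, Fin.snoc (α := fun _ => β) t.2.2.2 t.2.1))
        (by ext1 x; simp [itinerary_succ]) (by ext1 x; simp [itinerary_succ])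
    have e2 : fibreEntropy m (fun x => (g (T^[n] x), itinerary T f n x, itinerary T g n x)) =
        fibreEntropy m (fun x => (itinerary T f n x, itinerary T g n x, g (T^[n] x))) :=
      fibreEntropy_congr (mgn.prodMk ((mF n).prodMk (mG n))) ((mF n).prodMk ((mG n).prodMk mgn))
        (fun t => (t.2.1, t.2.2, t.1)) (fun t => (t.2.2, t.1, t.2.1)) rfl rfl
    have e3 : fibreEntropy m (fun x => (itinerary T g n x, g (T^[n] x))) =
        fibreEntropy m (itinerary T g (n + 1)) :=
      fibreEntropy_congr ((mG n).prodMk mgn) (mG (n + 1))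
        (fun t => Fin.snoc (α := fun _ => β) t.1 t.2) (fun t => (Fin.init t, t (Fin.last n)))
        (by ext1 x; simp [itinerary_succ]) (by ext1 x; simp [itinerary_succ])
    have e4 : fibreEntropy m (fun x => (f (T^[n] x), g (T^[n] x))) =
        fibreEntropy m (fun x => (f x, g x)) :=
      fibreEntropy_comp_measurePreserving (F := fun x => (f x, g x)) (hT.iterate n) (hf.prodMk hg)
    have e5 : fibreEntropy m (fun x => g (T^[n] x)) = fibreEntropy m g :=
      fibreEntropy_comp_measurePreserving (F := g) (hT.iterate n) hg
    push_cast
    linarith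

/-- The itinerary entropies grow by at most the conditional entropy in each step. -/
theorem fibreEntropy_itinerary_le {T : X → X} (hT : MeasurePreserving T m m) {f : X → α}
    {g : X → β} (hf : Measurable f) (hg : Measurable g) (n : ℕ) :
    fibreEntropy m (itinerary T f n) ≤ fibreEntropy m (itinerary T g n) +
        n * (fibreEntropy m (fun x => (f x, g x)) - fibreEntropy m g) :=
  (fibreEntropy_le_prodMk (measurable_itinerary hT.measurable hf n)
    (measurable_itinerary hT.measurable hg n)).trans (fibreEntropy_itinerary_prod_le hT hf hg n)

/-- The increments of the itinerary entropies are nonincreasing. -/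
theorem fibreEntropy_itinerary_concave {T : X → X} (hT : MeasurePreserving T m m) {f : X → α}
    (hf : Measurable f) (n : ℕ) :
    fibreEntropy m (itinerary T f (n + 2)) + fibreEntropy m (itinerary T f n) ≤
      2 * fibreEntropy m (itinerary T f (n + 1)) := by
  have mF := measurable_itinerary hT.measurable hf
  have mn : Measurable fun x => f (T^[n] (T x)) :=
    hf.comp ((hT.measurable.iterate n).comp hT.measurable)
  have mT : Measurable fun x => itinerary T f n (T x) := (mF n).comp hT.measurable
  -- The three functions are the first letter, the `n` middle letters and the last letter of a block
  -- of length `n + 2`.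
  have h := fibreEntropy_strong_subadditive (m := m) hf mT mn
  have e1 : fibreEntropy m (fun x => (f x, itinerary T f n (T x), f (T^[n] (T x)))) =
      fibreEntropy m (itinerary T f (n + 2)) :=
    fibreEntropy_congr (hf.prodMk (mT.prodMk mn)) (mF _)
      (fun t => Fin.cons (α := fun _ => α) t.1 (Fin.snoc (α := fun _ => α) t.2.1 t.2.2))
      (fun w => (w 0, Fin.init (Fin.tail w), Fin.tail w (Fin.last n)))
      (by ext1 x; simp [itinerary_succ' T f (n + 1), itinerary_succ T f n])
      (by ext1 x; simp [itinerary_succ' T f (n + 1), itinerary_succ T f n])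
  have e2 : fibreEntropy m (fun x => itinerary T f n (T x)) = fibreEntropy m (itinerary T f n) :=
    fibreEntropy_comp_measurePreserving (F := itinerary T f n) hT (mF n)
  have e3 : fibreEntropy m (fun x => (f x, itinerary T f n (T x))) =
      fibreEntropy m (itinerary T f (n + 1)) :=
    fibreEntropy_congr (hf.prodMk mT) (mF _)
      (fun t => Fin.cons (α := fun _ => α) t.1 t.2) (fun w => (w 0, Fin.tail w))
      (by ext1 x; simp [itinerary_succ']) (by ext1 x; simp [itinerary_succ'])
  have e4 : fibreEntropy m (fun x => (itinerary T f n (T x), f (T^[n] (T x)))) =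
      fibreEntropy m (itinerary T f (n + 1)) := by
    rw [← fibreEntropy_comp_measurePreserving hT (mF (n + 1))]
    exact fibreEntropy_congr (mT.prodMk mn) ((mF _).comp hT.measurable)
      (fun t => Fin.snoc (α := fun _ => α) t.1 t.2) (fun w => (Fin.init w, w (Fin.last n)))
      (by ext1 x; simp [itinerary_succ]) (by ext1 x; simp [itinerary_succ])
  linarith

/-- Once an increment of the itinerary entropies is at most `c`, all later ones are. -/
theorem fibreEntropy_itinerary_le_of_increment_le {T : X → X} (hT : MeasurePreserving T m m)
    {f : X → α} (hf : Measurable f) {n : ℕ} {c : ℝ}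
    (h : fibreEntropy m (itinerary T f (n + 1)) - fibreEntropy m (itinerary T f n) ≤ c) (k : ℕ) :
    fibreEntropy m (itinerary T f (n + k)) ≤ fibreEntropy m (itinerary T f n) + k * c := by
  have h1 : ∀ k, fibreEntropy m (itinerary T f (n + k + 1)) -
      fibreEntropy m (itinerary T f (n + k)) ≤ c := by
    intro k
    induction k with
    | zero => exact h
    | succ k ih =>
      have := fibreEntropy_itinerary_concave (m := m) hT hf (n + k)
      rw [show n + k + 2 = n + (k + 1) + 1 by ring, show n + k + 1 = n + (k + 1) by ring] at this
      rw [show n + k + 1 = n + (k + 1) by ring] at ih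
      linarith
  induction k with
  | zero => simp
  | succ k ih =>
    have := h1 k
    rw [← add_assoc]
    push_cast
    linarith

end Conditional

/-! ### Perron-Frobenius theory of irreducible matrices -/

section PerronFrobenius

open Matrix

variable {ι : Type*} [Fintype ι] [DecidableEq ι] {A : Matrix ι ι ℝ}

theorem mulVec_pos_of_pos {B : Matrix ι ι ℝ} (hB : ∀ i j, 0 < B i j) {x : ι → ℝ}
    (hx : ∀ i, 0 ≤ x i) (hx0 : x ≠ 0) (i : ι) : 0 < (B *ᵥ x) i := by
  obtain ⟨j, hj⟩ := Function.ne_iff.1 hx0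
  exact Finset.sum_pos' (fun k _ => mul_nonneg (hB i k).le (hx k))
    ⟨j, Finset.mem_univ j, mul_pos (hB i j) ((hx j).lt_of_ne (Ne.symm hj))⟩

/-- Some sum of powers of an irreducible matrix is positive. -/
theorem exists_sum_pow_pos (hA : A.IsIrreducible) :
    ∃ K : ℕ, ∀ i j, 0 < (∑ k ∈ Finset.range K, A ^ k) i j := by
  have h := (isIrreducible_iff_exists_pow_pos hA.nonneg).1 hA
  choose k _ hk using h
  refine ⟨(Finset.univ.sup fun q : ι × ι => k q.1 q.2) + 1, fun i j => ?_⟩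
  rw [Matrix.sum_apply]
  refine Finset.sum_pos' (fun n _ => pow_apply_nonneg hA.nonneg n i j) ⟨k i j, ?_, hk i j⟩
  rw [Finset.mem_range, Nat.lt_succ_iff]
  exact Finset.le_sup (f := fun q : ι × ι => k q.1 q.2) (Finset.mem_univ (i, j))

theorem pow_mulVec_eigenvector {t : ℝ} {x : ι → ℝ} (h : A *ᵥ x = t • x) (k : ℕ) :
    (A ^ k) *ᵥ x = t ^ k • x := by
  induction k with
  | zero => simp
  | succ k ih => rw [pow_succ, ← mulVec_mulVec, h, mulVec_smul, ih, smul_smul, pow_succ']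

theorem sum_pow_mulVec_eigenvector {t : ℝ} {x : ι → ℝ} (h : A *ᵥ x = t • x) (K : ℕ) :
    (∑ k ∈ Finset.range K, A ^ k) *ᵥ x = (∑ k ∈ Finset.range K, t ^ k) • x := by
  rw [sum_mulVec, Finset.sum_smul]
  exact Finset.sum_congr rfl fun k _ => pow_mulVec_eigenvector h k

/-- The Collatz-Wielandt argument: among the pairs with `x` in the simplex and `t * x ≤ A *ᵥ x`,
take one with `t` maximal. If equality failed somewhere, the positive matrix `B`, which commutes
with `A`, would make the inequality strict in every coordinate of `B *ᵥ x`, and `t` could be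
increased. -/
theorem exists_pos_eigenvector [Nonempty ι] (hA : A.IsIrreducible) :
    ∃ t : ℝ, 0 < t ∧ ∃ x : ι → ℝ, (∀ i, 0 < x i) ∧ A *ᵥ x = t • x := by
  obtain ⟨K, hK⟩ := exists_sum_pow_pos hA
  set B := ∑ k ∈ Finset.range K, A ^ k with hB
  set R := ∑ i, ∑ j, A i j with hR
  have hR0 : 0 ≤ R := Finset.sum_nonneg fun i _ => Finset.sum_nonneg fun j _ => hA.nonneg i j
  have bound : ∀ (t : ℝ) (x : ι → ℝ), x ∈ stdSimplex ℝ ι → (∀ i, t * x i ≤ (A *ᵥ x) i) →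
      t ≤ R := by
    intro t x hx h
    have h1 : ∑ i, t * x i ≤ ∑ i, (A *ᵥ x) i := Finset.sum_le_sum fun i _ => h i
    rw [← Finset.mul_sum, hx.2, mul_one] at h1
    refine h1.trans (Finset.sum_le_sum fun i _ => Finset.sum_le_sum fun j _ => ?_)
    have : x j ≤ 1 := by
      rw [← hx.2]
      exact Finset.single_le_sum (fun k _ => hx.1 k) (Finset.mem_univ j)
    exact mul_le_of_le_one_right (hA.nonneg i j) this
  set S : Set (ℝ × (ι → ℝ)) :=
    (Set.Icc 0 R ×ˢ stdSimplex ℝ ι) ∩ {q | ∀ i, q.1 * q.2 i ≤ (A *ᵥ q.2) i} with hS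
  have hScomp : IsCompact S := by
    refine (isCompact_Icc.prod (isCompact_stdSimplex ℝ ι)).inter_right ?_
    rw [Set.ofPred_forall]
    refine isClosed_iInter fun i => isClosed_le (by fun_prop) ?_
    exact (continuous_apply i).comp (continuous_const.matrix_mulVec continuous_snd)
  have hSne : S.Nonempty := by
    refine ⟨(0, Pi.single (Classical.arbitrary ι) 1), ⟨⟨le_rfl, hR0⟩, single_mem_stdSimplex ..⟩, ?_⟩
    intro i
    simp [hA.nonneg]
  obtain ⟨⟨t, x⟩, ⟨⟨ht, hx⟩, htx⟩, hmax⟩ := hScomp.exists_isMaxOn hSne continuous_fst.continuousOn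
  simp only [Set.mem_ofPred_eq] at ht hx htx
  have hx0 : x ≠ 0 := by
    rintro rfl
    simpa using hx.2
  have heig : A *ᵥ x = t • x := by
    by_contra hne
    have hw : A *ᵥ x - t • x ≠ 0 := sub_ne_zero.2 hne
    have hw' := mulVec_pos_of_pos hK (x := A *ᵥ x - t • x) (fun i => by simpa using htx i) hw
    have hy := mulVec_pos_of_pos hK (x := x) hx.1 hx0
    set y := B *ᵥ x with hyd
    have hcomm : B *ᵥ (A *ᵥ x - t • x) = A *ᵥ y - t • y := by
      rw [mulVec_sub, mulVec_smul, hyd, mulVec_mulVec, mulVec_mulVec]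
      congr 2
      exact (Commute.sum_left _ _ _ fun k _ => (Commute.refl A).pow_left k).eq
    rw [hcomm] at hw'
    -- The smallest relative surplus `ε` is the amount by which `t` can be raised.
    obtain ⟨i₀, hi₀⟩ := Finite.exists_min fun i => (A *ᵥ y - t • y) i / y i
    set ε := (A *ᵥ y - t • y) i₀ / y i₀ with hε
    have hε0 : 0 < ε := div_pos (hw' _) (hy _)
    have hyε : ∀ i, (t + ε) * y i ≤ (A *ᵥ y) i := by
      intro i
      have := (le_div_iff₀ (hy i)).1 (hi₀ i)
      simp only [Pi.sub_apply, Pi.smul_apply, smul_eq_mul] at this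
      linarith
    set s := ∑ i, y i with hs
    have hs0 : 0 < s := Finset.sum_pos (fun i _ => hy i) Finset.univ_nonempty
    have hmem : s⁻¹ • y ∈ stdSimplex ℝ ι := by
      refine ⟨fun i => mul_nonneg (inv_pos.2 hs0).le (hy i).le, ?_⟩
      simp only [Pi.smul_apply, smul_eq_mul]
      rw [← Finset.mul_sum, ← hs, inv_mul_cancel₀ hs0.ne']
    have hle : ∀ i, (t + ε) * (s⁻¹ • y) i ≤ (A *ᵥ (s⁻¹ • y)) i := by
      intro i
      rw [mulVec_smul]
      simp only [Pi.smul_apply, smul_eq_mul]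
      calc _ = s⁻¹ * ((t + ε) * y i) := by ring
        _ ≤ _ := mul_le_mul_of_nonneg_left (hyε i) (inv_pos.2 hs0).le
    have h2 : t + ε ≤ t := hmax (a := (t + ε, s⁻¹ • y))
      ⟨⟨⟨by linarith [ht.1], bound _ _ hmem hle⟩, hmem⟩, hle⟩
    linarith
  have hpos : ∀ i, 0 < x i := by
    intro i
    have h1 := mulVec_pos_of_pos hK hx.1 hx0 i
    rw [hB, sum_pow_mulVec_eigenvector heig] at h1
    refine (hx.1 i).lt_of_ne fun h => ?_
    simp [← h] at h1
  refine ⟨t, ht.1.lt_of_ne fun h => ?_, x, hpos, heig⟩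
  obtain ⟨i⟩ := ‹Nonempty ι›
  -- For `t = 0` the vector `A ^ k *ᵥ x` would vanish, although a closed path of length `k` at `i`
  -- makes its entry at `i` positive.
  obtain ⟨k, hk, hki⟩ := (isIrreducible_iff_exists_pow_pos hA.nonneg).1 hA i i
  have h1 := congrFun (pow_mulVec_eigenvector heig k) i
  rw [← h, zero_pow hk.ne', zero_smul] at h1
  have h2 : 0 < (A ^ k *ᵥ x) i :=
    Finset.sum_pos' (fun j _ => mul_nonneg (pow_apply_nonneg hA.nonneg k i j) (hpos j).le)
      ⟨i, Finset.mem_univ i, mul_pos hki (hpos i)⟩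
  exact h2.ne' h1

/-- A positive eigenvector of an irreducible matrix spans its eigenspace. -/
theorem eigenvector_unique [Nonempty ι] (hA : A.IsIrreducible) {t : ℝ} {x y : ι → ℝ}
    (hx : ∀ i, 0 < x i) (hAx : A *ᵥ x = t • x) (hAy : A *ᵥ y = t • y) : ∃ c : ℝ, y = c • x := by
  obtain ⟨K, hK⟩ := exists_sum_pow_pos hA
  -- With the smallest ratio as `c`, the eigenvector `y - c • x` is nonnegative and vanishes at
  -- `i₀`. Were it nonzero, a sum of powers of `A` would make it positive there while only rescaling
  -- it.
  obtain ⟨i₀, hi₀⟩ := Finite.exists_min fun i => y i / x i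
  refine ⟨y i₀ / x i₀, ?_⟩
  set c := y i₀ / x i₀ with hc
  by_contra hne
  have hw : A *ᵥ (y - c • x) = t • (y - c • x) := by
    rw [mulVec_sub, mulVec_smul, hAx, hAy, smul_sub, smul_comm]
  have h1 := mulVec_pos_of_pos hK (x := y - c • x) (fun i => by
    have := (le_div_iff₀ (hx i)).1 (hi₀ i)
    simpa using this) (sub_ne_zero.2 hne) i₀
  rw [sum_pow_mulVec_eigenvector hw] at h1
  have h2 : (y - c • x) i₀ = 0 := by
    simp [hc, (hx i₀).ne']
  simp only [Pi.smul_apply, h2, smul_zero, lt_irrefl] at h1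

/-- `t` is a positive eigenvalue of `A` with positive left and right eigenvectors `u` and `v`,
normalized by `∑ u i * v i = 1`. -/
structure IsPositiveEigenTriple (A : Matrix ι ι ℝ) (t : ℝ) (u v : ι → ℝ) : Prop where
  pos : 0 < t
  left_pos : ∀ i, 0 < u i
  right_pos : ∀ i, 0 < v i
  left_eq : u ᵥ* A = t • u
  right_eq : A *ᵥ v = t • v
  dot_eq : u ⬝ᵥ v = 1

theorem IsPositiveEigenTriple.transpose {t : ℝ} {u v : ι → ℝ}
    (h : IsPositiveEigenTriple A t u v) : IsPositiveEigenTriple Aᵀ t v u where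
  pos := h.pos
  left_pos := h.right_pos
  right_pos := h.left_pos
  left_eq := by rw [vecMul_transpose, h.right_eq]
  right_eq := by rw [mulVec_transpose, h.left_eq]
  dot_eq := by rw [dotProduct_comm, h.dot_eq]

theorem IsPositiveEigenTriple.sum_right {t : ℝ} {u v : ι → ℝ}
    (h : IsPositiveEigenTriple A t u v) (i : ι) : ∑ j, A i j * v j = t * v i :=
  congrFun h.right_eq i

theorem IsPositiveEigenTriple.sum_left {t : ℝ} {u v : ι → ℝ}
    (h : IsPositiveEigenTriple A t u v) (j : ι) : ∑ i, u i * A i j = t * u j :=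
  congrFun h.left_eq j

/-- The eigenvalues found for `A` and for its transpose agree: evaluate `u A v` in two ways and
cancel `u ⬝ᵥ v > 0`. -/
theorem exists_isPositiveEigenTriple [Nonempty ι] (hA : A.IsIrreducible) :
    ∃ (t : ℝ) (u v : ι → ℝ), IsPositiveEigenTriple A t u v := by
  obtain ⟨t, ht, v, hv, hAv⟩ := exists_pos_eigenvector hA
  obtain ⟨t', ht', u, hu, hAu⟩ := exists_pos_eigenvector hA.transpose
  rw [mulVec_transpose] at hAu
  have hs : 0 < u ⬝ᵥ v :=
    Finset.sum_pos (fun i _ => mul_pos (hu i) (hv i)) Finset.univ_nonempty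
  have h1 : t * (u ⬝ᵥ v) = t' * (u ⬝ᵥ v) := by
    have := dotProduct_mulVec u A v
    rw [hAv, hAu, dotProduct_smul, smul_dotProduct] at this
    simpa using this
  obtain rfl := mul_right_cancel₀ hs.ne' h1
  refine ⟨t, (u ⬝ᵥ v)⁻¹ • u, v, ht, fun i => mul_pos (inv_pos.2 hs) (hu i), hv, ?_, hAv, ?_⟩
  · rw [smul_vecMul, hAu, smul_comm]
  · rw [smul_dotProduct, smul_eq_mul, inv_mul_cancel₀ hs.ne']

/-- Taking absolute values in the eigenvector equation gives `‖z‖ * ‖w i‖ ≤ ∑ j, A i j * ‖w j‖`;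
pairing with the positive left eigenvector turns the right side into `t` times the same positive
sum. -/
theorem norm_eigenvalue_le (hA : ∀ i j, 0 ≤ A i j) {t : ℝ} {u v : ι → ℝ}
    (h : IsPositiveEigenTriple A t u v) {z : ℂ}
    (hz : Module.End.HasEigenvalue (toLin' (A.map Complex.ofReal)) z) : ‖z‖ ≤ t := by
  obtain ⟨w, hw⟩ := hz.exists_hasEigenvector
  have hw1 := hw.apply_eq_smul
  rw [toLin'_apply] at hw1
  have key : ∀ i, ‖z‖ * ‖w i‖ ≤ ∑ j, A i j * ‖w j‖ := by
    intro i
    have := congrFun hw1 i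
    rw [Pi.smul_apply, smul_eq_mul] at this
    rw [← norm_mul, ← this]
    refine (norm_sum_le _ _).trans (Finset.sum_le_sum fun j _ => ?_)
    simp [abs_of_nonneg (hA i j)]
  have hsum : ∑ i, u i * (‖z‖ * ‖w i‖) ≤ ∑ i, u i * ∑ j, A i j * ‖w j‖ :=
    Finset.sum_le_sum fun i _ => mul_le_mul_of_nonneg_left (key i) (h.left_pos i).le
  have e1 : ∑ i, u i * ∑ j, A i j * ‖w j‖ = t * ∑ j, u j * ‖w j‖ := by
    simp_rw [Finset.mul_sum]
    rw [Finset.sum_comm]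
    refine Finset.sum_congr rfl fun j _ => ?_
    simp_rw [← mul_assoc]
    rw [← Finset.sum_mul, h.sum_left]
  have e2 : ∑ i, u i * (‖z‖ * ‖w i‖) = ‖z‖ * ∑ j, u j * ‖w j‖ := by
    rw [Finset.mul_sum]
    exact Finset.sum_congr rfl fun i _ => by ring
  rw [e1, e2] at hsum
  refine le_of_mul_le_mul_right hsum ?_
  obtain ⟨j, hj⟩ := Function.ne_iff.1 hw.2
  exact Finset.sum_pos' (fun i _ => mul_nonneg (h.left_pos i).le (norm_nonneg _))
    ⟨j, Finset.mem_univ j, mul_pos (h.left_pos j) (norm_pos_iff.2 hj)⟩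

theorem hasEigenvalue_map_ofReal {t : ℝ} (h : Module.End.HasEigenvalue (toLin' A) t) :
    Module.End.HasEigenvalue (toLin' (A.map Complex.ofReal)) (t : ℂ) := by
  obtain ⟨w, hw⟩ := h.exists_hasEigenvector
  have hw1 := hw.apply_eq_smul
  rw [toLin'_apply] at hw1
  refine Module.End.hasEigenvalue_of_hasEigenvector (x := fun i => (w i : ℂ)) ⟨?_, ?_⟩
  · rw [Module.End.mem_eigenspace_iff, toLin'_apply]
    ext i
    have := congrArg Complex.ofReal (congrFun hw1 i)
    simpa [mulVec, dotProduct] using this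
  · intro h0
    refine hw.2 (funext fun i => ?_)
    simpa using congrFun h0 i

end PerronFrobenius

/-! ### Perron triples and their uniqueness up to scaling. -/

section PerronTriple

variable {N : ℕ} {A : Matrix (Fin N) (Fin N) ℝ} {t : ℝ} {u v : Fin N → ℝ}

theorem IsPositiveEigenTriple.isPerronTriple [NeZero N] (hA : ∀ i j, 0 ≤ A i j)
    (h : IsPositiveEigenTriple A t u v) : IsPerronTriple A t u v := by
  refine ⟨⟨h.pos.le, ?_, fun z hz => norm_eigenvalue_le hA h hz⟩, h.left_eq, h.right_eq, h.dot_eq⟩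
  refine Module.End.hasEigenvalue_of_hasEigenvector (x := v) ⟨?_, fun h0 => ?_⟩
  · rw [Module.End.mem_eigenspace_iff, Matrix.toLin'_apply, h.right_eq]
  · exact (h.right_pos 0).ne' (congrFun h0 0)

/-- This is what makes the Parry formula independent of the chosen triple, whatever its signs: only
products of one entry of `U` and one of `V` occur. The two eigenvalues agree because each bounds the
other. -/
theorem IsPerronTriple.eq_smul [NeZero N] (hA : A.IsIrreducible)
    (h : IsPositiveEigenTriple A t u v) {t' : ℝ} {U V : Fin N → ℝ}
    (h' : IsPerronTriple A t' U V) : t' = t ∧ ∃ c : ℝ, c ≠ 0 ∧ U = c • u ∧ V = c⁻¹ • v := by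
  obtain ⟨⟨h0, hev, hmax⟩, hU, hV, hUV⟩ := h'
  have hP := h.isPerronTriple hA.nonneg
  have h1 : t' ≤ t := by
    have := norm_eigenvalue_le hA.nonneg h (hasEigenvalue_map_ofReal hev)
    rwa [Complex.norm_real, Real.norm_of_nonneg h0] at this
  have h2 : t ≤ t' := by
    have := hmax _ (hasEigenvalue_map_ofReal hP.1.2.1)
    rwa [Complex.norm_real, Real.norm_of_nonneg h.pos.le] at this
  obtain rfl := le_antisymm h1 h2
  obtain ⟨d, hd⟩ := eigenvector_unique hA h.right_pos h.right_eq hV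
  obtain ⟨c, hc⟩ := eigenvector_unique hA.transpose h.left_pos h.transpose.right_eq
    (y := U) (by rw [Matrix.mulVec_transpose, hU])
  have hcd : c * d = 1 := by
    rw [hc, hd, smul_dotProduct, dotProduct_smul, h.dot_eq] at hUV
    simpa using hUV
  have hc0 : c ≠ 0 := left_ne_zero_of_mul_eq_one hcd
  exact ⟨rfl, c, hc0, hc, by rw [hd, eq_inv_of_mul_eq_one_right hcd]⟩

end PerronTriple

/-! ### Cyclic classes and the asymptotics of matrix powers -/

section Cyclic

open Matrix

variable {ι : Type*} [Fintype ι] [DecidableEq ι] {A : Matrix ι ι ℝ}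

theorem pow_apply_pos_trans (hA : ∀ i j, 0 ≤ A i j) {a b : ℕ} {i j k : ι} (h1 : 0 < (A ^ a) i j)
    (h2 : 0 < (A ^ b) j k) : 0 < (A ^ (a + b)) i k := by
  rw [pow_add, mul_apply]
  exact Finset.sum_pos' (fun l _ => mul_nonneg (pow_apply_nonneg hA a i l)
    (pow_apply_nonneg hA b l k)) ⟨j, Finset.mem_univ j, mul_pos h1 h2⟩

/-- `c` assigns cyclic classes modulo `p` to the indices of `A`: steps of `A` lead from a class to
the next one, and all powers of exponent at least `M` are positive wherever the classes allow. -/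
structure IsCyclic (A : Matrix ι ι ℝ) {p : ℕ} (c : ι → ZMod p) (M : ℕ) : Prop where
  nonneg : ∀ i j, 0 ≤ A i j
  step : ∀ i j, 0 < A i j → c j = c i + 1
  pow_pos : ∀ m, M ≤ m → ∀ i j, c j = c i + m → 0 < (A ^ m) i j

theorem IsCyclic.transpose {p : ℕ} {c : ι → ZMod p} {M : ℕ} (h : IsCyclic A c M) :
    IsCyclic Aᵀ (fun i => - c i) M where
  nonneg i j := h.nonneg j i
  step i j hij := by rw [h.step j i hij]; ring
  pow_pos m hm i j hij := by
    rw [← transpose_pow]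
    refine h.pow_pos m hm j i ?_
    linear_combination hij

/-- An irreducible matrix of period `p` has `p` cyclic classes. -/
theorem exists_isCyclic (hA : A.IsIrreducible) {p : ℕ} (i₀ : ι)
    (hp : Nat.setGcd {n : ℕ | 1 ≤ n ∧ 0 < (A ^ n) i₀ i₀} = p) :
    ∃ (c : ι → ZMod p) (M : ℕ), IsCyclic A c M := by
  have hirr := (isIrreducible_iff_exists_pow_pos hA.nonneg).1 hA
  choose n hn hnpos using hirr i₀
  choose r hr hrpos using fun i => hirr i i₀
  set S : Set ℕ := {n : ℕ | 1 ≤ n ∧ 0 < (A ^ n) i₀ i₀} with hS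
  have hdvd : ∀ {m : ℕ}, 1 ≤ m → 0 < (A ^ m) i₀ i₀ → ((m : ℕ) : ZMod p) = 0 := by
    intro m h1 h2
    rw [ZMod.natCast_eq_zero_iff, ← hp]
    exact Nat.setGcd_dvd_of_mem ⟨h1, h2⟩
  -- Closing a path from `i₀` to `i` by the fixed return path of length `r i` gives a closed path,
  -- so the lengths of all paths from `i₀` to `i` agree modulo `p`; this residue is the class of
  -- `i`.
  have hrn : ∀ i {m : ℕ}, 0 < (A ^ m) i₀ i → (m : ZMod p) + r i = 0 := by
    intro i m hm
    have := hdvd (m := m + r i) (by have := hr i; omega)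
      (pow_apply_pos_trans hA.nonneg hm (hrpos i))
    exact_mod_cast this
  -- All large multiples of the gcd are sums of return times, and return times are closed under
  -- addition.
  obtain ⟨K, hK⟩ := Nat.exists_mem_closure_of_ge S
  have hcl : ∀ m ∈ AddSubmonoid.closure S, 0 < (A ^ m) i₀ i₀ := by
    intro m hm
    induction hm using AddSubmonoid.closure_induction with
    | mem x hx => exact hx.2
    | zero => simp
    | add x y _ _ hx hy => exact pow_apply_pos_trans hA.nonneg hx hy
  refine ⟨fun i => (n i : ZMod p), K + Finset.univ.sup r + Finset.univ.sup n, hA.nonneg, ?_, ?_⟩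
  · intro i j hij
    have h1 : 0 < (A ^ (n i + 1)) i₀ j :=
      pow_apply_pos_trans hA.nonneg (hnpos i) (by simpa using hij)
    have h2 := hrn j h1
    have h3 := hrn j (hnpos j)
    push_cast at h2
    linear_combination h3 - h2
  · intro m hm i j hij
    have h1 : r i ≤ Finset.univ.sup r := Finset.le_sup (Finset.mem_univ i)
    have h2 : n j ≤ Finset.univ.sup n := Finset.le_sup (Finset.mem_univ j)
    -- Go from `i` to `i₀`, stay at `i₀` for a return time `s`, then go on to `j`; the class
    -- condition says that `p` divides `s`.
    obtain ⟨s, rfl⟩ : ∃ s, m = r i + s + n j := ⟨m - r i - n j, by omega⟩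
    have h3 := hrn i (hnpos i)
    have hs : (s : ZMod p) = 0 := by
      push_cast at hij
      linear_combination -hij - h3
    rw [ZMod.natCast_eq_zero_iff, ← hp] at hs
    exact pow_apply_pos_trans hA.nonneg (pow_apply_pos_trans hA.nonneg (hrpos i)
      (hcl s (hK s (by omega) hs))) (hnpos j)

/-- A primitive matrix has period `1`. -/
theorem setGcd_eq_one_of_isPrimitive (hA : A.IsPrimitive) (i : ι) :
    Nat.setGcd {n : ℕ | 1 ≤ n ∧ 0 < (A ^ n) i i} = 1 := by
  obtain ⟨h0, k, hk, hpos⟩ := hA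
  have hrow : ∃ l, 0 < A i l := by
    by_contra! h
    have h' : ∀ l, A i l = 0 := fun l => le_antisymm (h l) (h0 i l)
    obtain ⟨k, rfl⟩ := Nat.exists_eq_succ_of_ne_zero hk.ne'
    have := hpos i i
    rw [pow_succ', mul_apply] at this
    simp [h'] at this
  obtain ⟨l, hl⟩ := hrow
  -- There are closed paths of the consecutive lengths `k` and `1 + k`.
  have h1 : 0 < (A ^ (1 + k)) i i := pow_apply_pos_trans h0 (by simpa using hl) (hpos l i)
  have d1 := Nat.setGcd_dvd_of_mem (s := {n : ℕ | 1 ≤ n ∧ 0 < (A ^ n) i i}) ⟨hk, hpos i i⟩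
  have d2 := Nat.setGcd_dvd_of_mem (s := {n : ℕ | 1 ≤ n ∧ 0 < (A ^ n) i i})
    (n := 1 + k) ⟨by omega, h1⟩
  exact Nat.dvd_one.1 ((Nat.dvd_add_left d1).1 d2)

/-! #### Stochastic matrices with cyclic classes -/

section Stochastic

variable {P : Matrix ι ι ℝ} {p : ℕ} {c : ι → ZMod p} {M : ℕ}

/-- The independent coupling: a difference of two means is a mean of differences. -/
theorem sum_mul_sub_sum_mul {f : ι → ℝ} {a b : ι → ℝ} (ha : ∑ j, a j = 1) (hb : ∑ j, b j = 1) :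
    ∑ j, a j * f j - ∑ j, b j * f j = ∑ j, ∑ k, a j * b k * (f j - f k) := by
  have e1 : ∑ j, ∑ k, a j * b k * f j = ∑ j, a j * f j := by
    refine Finset.sum_congr rfl fun j _ => ?_
    rw [← Finset.sum_mul, ← Finset.mul_sum, hb, mul_one]
  have e2 : ∑ j, ∑ k, a j * b k * f k = ∑ k, b k * f k := by
    rw [Finset.sum_comm]
    refine Finset.sum_congr rfl fun k _ => ?_
    rw [← Finset.sum_mul, ← Finset.sum_mul, ha, one_mul]
  simp_rw [mul_sub, Finset.sum_sub_distrib, e1, e2]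

theorem IsCyclic.eq_zero (hP : IsCyclic P c M) {i j : ι} (h : c j ≠ c i + 1) : P i j = 0 :=
  (hP.nonneg i j).antisymm' (not_lt.1 fun h' => h (hP.step i j h'))

theorem IsCyclic.pow_step (hP : IsCyclic P c M) (m : ℕ) (i j : ι) (h : (P ^ m) i j ≠ 0) :
    c j = c i + m := by
  induction m generalizing j with
  | zero =>
    have : i = j := by
      by_contra hne
      simp [one_apply_ne hne] at h
    simp [this]
  | succ m ih =>
    rw [pow_succ, mul_apply] at h
    obtain ⟨l, -, hl⟩ := Finset.exists_ne_zero_of_sum_ne_zero h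
    have h1 := ih l (left_ne_zero_of_mul hl)
    have h2 : c j = c l + 1 := by
      by_contra hne
      exact right_ne_zero_of_mul hl (hP.eq_zero hne)
    rw [h2, h1]
    push_cast
    ring

theorem sum_pow_apply_eq_one (hrow : ∀ i, ∑ j, P i j = 1) (m : ℕ) (i : ι) :
    ∑ j, (P ^ m) i j = 1 := by
  have h : P *ᵥ 1 = (1 : ℝ) • 1 := by
    ext i
    simp [mulVec, dotProduct, hrow]
  have := congrFun (pow_mulVec_eigenvector h m) i
  simpa [mulVec, dotProduct] using this

/-- `d` bounds the oscillation of `f` on each cyclic class. -/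
def ClassOscLE (c : ι → ZMod p) (f : ι → ℝ) (d : ℝ) : Prop :=
  ∀ i i', c i = c i' → f i - f i' ≤ d

/-- Two indices of one class are carried by `m` steps into one common class, so the coupling
compares values of `f` within a class only. -/
theorem IsCyclic.classOscLE_pow_mulVec (hP : IsCyclic P c M) (hrow : ∀ i, ∑ j, P i j = 1)
    {f : ι → ℝ} {d : ℝ} (hf : ClassOscLE c f d) (m : ℕ) : ClassOscLE c ((P ^ m) *ᵥ f) d := by
  intro i i' hii'
  have h1 := sum_pow_apply_eq_one hrow m
  calc _ = ∑ j, ∑ k, (P ^ m) i j * (P ^ m) i' k * (f j - f k) :=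
        sum_mul_sub_sum_mul (h1 i) (h1 i')
    _ ≤ ∑ j, ∑ k, (P ^ m) i j * (P ^ m) i' k * d := by
        refine Finset.sum_le_sum fun j _ => Finset.sum_le_sum fun k _ => ?_
        by_cases hj : (P ^ m) i j = 0
        · simp [hj]
        by_cases hk : (P ^ m) i' k = 0
        · simp [hk]
        refine mul_le_mul_of_nonneg_left (hf _ _ ?_) (mul_nonneg
          (pow_apply_nonneg hP.nonneg m i j) (pow_apply_nonneg hP.nonneg m i' k))
        rw [hP.pow_step m i j hj, hP.pow_step m i' k hk, hii']
    _ = d := by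
        simp_rw [← Finset.sum_mul, ← Finset.mul_sum, h1, mul_one, h1, one_mul]

/-- Doeblin's argument: from two indices of the same class, the coupled chains meet at `e i` after
`M` steps with a probability bounded below. The difference of values is zero there, so the
oscillation bound loses that proportion. -/
theorem IsCyclic.exists_contraction [Nonempty ι] (hP : IsCyclic P c M)
    (hrow : ∀ i, ∑ j, P i j = 1) :
    ∃ ρ : ℝ, 0 ≤ ρ ∧ ρ < 1 ∧ ∀ (f : ι → ℝ) (d : ℝ), 0 ≤ d → ClassOscLE c f d →
      ClassOscLE c ((P ^ M) *ᵥ f) (ρ * d) := by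
  have h1 := sum_pow_apply_eq_one hrow M
  have hn := pow_apply_nonneg hP.nonneg M
  have hex : ∀ i, ∃ j, (P ^ M) i j ≠ 0 := by
    intro i
    obtain ⟨j, -, hj⟩ := Finset.exists_ne_zero_of_sum_ne_zero (s := Finset.univ)
      (f := fun j => (P ^ M) i j) (by rw [h1]; exact one_ne_zero)
    exact ⟨j, hj⟩
  choose e he using hex
  have hpos : ∀ i i', c i = c i' → 0 < (P ^ M) i (e i) * (P ^ M) i' (e i) := by
    intro i i' h
    refine mul_pos ((hn _ _).lt_of_ne (he i).symm) (hP.pow_pos M le_rfl _ _ ?_)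
    rw [hP.pow_step M i _ (he i), h]
  have hle1 : ∀ i j, (P ^ M) i j ≤ 1 := fun i j => by
    rw [← h1 i]
    exact Finset.single_le_sum (fun k _ => hn i k) (Finset.mem_univ j)
  -- The value `1` for pairs from different classes is a dummy: it lets the minimum run over all
  -- pairs and stay in `(0, 1]`.
  set w : ι × ι → ℝ := fun q =>
    if c q.1 = c q.2 then (P ^ M) q.1 (e q.1) * (P ^ M) q.2 (e q.1) else 1 with hw
  obtain ⟨q₀, hq₀⟩ := Finite.exists_min w
  have hw0 : 0 < w q₀ := by
    simp only [hw]
    split_ifs with h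
    · exact hpos _ _ h
    · exact one_pos
  have hw1 : w q₀ ≤ 1 := by
    simp only [hw]
    split_ifs with h
    · exact mul_le_one₀ (hle1 _ _) (hn _ _) (hle1 _ _)
    · exact le_rfl
  refine ⟨1 - w q₀, by linarith, by linarith, fun f d hd hf i i' hii' => ?_⟩
  have hwi : w q₀ ≤ (P ^ M) i (e i) * (P ^ M) i' (e i) := by
    have := hq₀ (i, i')
    simpa only [hw, hii', if_true] using this
  have key : ∀ j k, (P ^ M) i j * (P ^ M) i' k * (f j - f k) ≤
      (P ^ M) i j * (P ^ M) i' k * d -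
        (if j = e i then if k = e i then w q₀ * d else 0 else 0) := by
    intro j k
    have hgen : (P ^ M) i j * (P ^ M) i' k * (f j - f k) ≤ (P ^ M) i j * (P ^ M) i' k * d := by
      by_cases hj : (P ^ M) i j = 0
      · simp [hj]
      by_cases hk : (P ^ M) i' k = 0
      · simp [hk]
      refine mul_le_mul_of_nonneg_left (hf _ _ ?_) (mul_nonneg (hn i j) (hn i' k))
      rw [hP.pow_step M i j hj, hP.pow_step M i' k hk, hii']
    split_ifs with hj hk
    · subst hj; rw [hk]
      have := mul_le_mul_of_nonneg_right hwi hd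
      simp only [sub_self, mul_zero]
      linarith
    · simpa using hgen
    · simpa using hgen
  calc _ = ∑ j, ∑ k, (P ^ M) i j * (P ^ M) i' k * (f j - f k) :=
        sum_mul_sub_sum_mul (h1 i) (h1 i')
    _ ≤ _ := Finset.sum_le_sum fun j _ => Finset.sum_le_sum fun k _ => key j k
    _ = (1 - w q₀) * d := by
        simp_rw [Finset.sum_sub_distrib, ← Finset.sum_mul, ← Finset.mul_sum, h1, mul_one, h1]
        simp
        ring

theorem IsCyclic.exists_classOscLE [Nonempty ι] (hP : IsCyclic P c M)
    (hrow : ∀ i, ∑ j, P i j = 1) (f : ι → ℝ) {ε : ℝ} (hε : 0 < ε) :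
    ∃ K, ∀ k, K ≤ k → ClassOscLE c ((P ^ k) *ᵥ f) ε := by
  obtain ⟨ρ, h0, h1, hc⟩ := hP.exists_contraction hrow
  obtain ⟨d, hd0, hd⟩ : ∃ d : ℝ, 0 ≤ d ∧ ClassOscLE c f d := by
    obtain ⟨q, hq⟩ := Finite.exists_max fun q : ι × ι => f q.1 - f q.2
    exact ⟨f q.1 - f q.2, by simpa using hq (q.1, q.1), fun i i' _ => hq (i, i')⟩
  have hn : ∀ n : ℕ, ClassOscLE c ((P ^ (M * n)) *ᵥ f) (ρ ^ n * d) := by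
    intro n
    induction n with
    | zero => simpa using hd
    | succ n ih =>
      have := hc _ _ (by positivity) ih
      rw [mulVec_mulVec, ← pow_add] at this
      rw [mul_add, mul_one, add_comm, pow_succ', mul_assoc]
      exact this
  have ht : Tendsto (fun n : ℕ => ρ ^ n * d) atTop (𝓝 0) := by
    simpa using (tendsto_pow_atTop_nhds_zero_of_lt_one h0 h1).mul_const d
  obtain ⟨n, hnε⟩ := (ht.eventually (gt_mem_nhds hε)).exists
  refine ⟨M * n, fun k hk => ?_⟩
  obtain ⟨l, rfl⟩ := Nat.exists_eq_add_of_le' hk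
  rw [pow_add, ← mulVec_mulVec]
  exact hP.classOscLE_pow_mulVec hrow (fun i i' h => (hn n i i' h).trans hnε.le) l

/-- The weights of the classes are carried along by a stationary vector. -/
theorem IsCyclic.sum_class_pow_mulVec (hP : IsCyclic P c M) {w : ι → ℝ}
    (hw : ∀ j, ∑ i, w i * P i j = w j) (f : ι → ℝ) (k : ℕ) (r : ZMod p) :
    ∑ i with c i = r, w i * ((P ^ k) *ᵥ f) i = ∑ j with c j = r + k, w j * f j := by
  induction k generalizing f with
  | zero => simp
  | succ k ih =>
    rw [pow_succ, ← mulVec_mulVec, ih]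
    simp_rw [Finset.sum_filter, mulVec, dotProduct, Finset.mul_sum]
    simp_rw [← Finset.sum_filter]
    rw [Finset.sum_comm]
    rw [Finset.sum_filter]
    refine Finset.sum_congr rfl fun j _ => ?_
    simp_rw [← mul_assoc, ← Finset.sum_mul]
    split_ifs with hj
    · congr 1
      rw [← hw j, Finset.sum_filter]
      refine Finset.sum_congr rfl fun i _ => ?_
      split_ifs with hi
      · rfl
      · rw [hP.eq_zero, mul_zero]
        intro h
        push_cast at hj
        exact hi (by linear_combination hj - h)
    · rw [Finset.sum_eq_zero, zero_mul]
      intro i hi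
      rw [hP.eq_zero, mul_zero]
      intro h
      rw [h, (Finset.mem_filter.1 hi).2] at hj
      push_cast at hj
      exact hj (by ring)

/-- Transporting the constant function `1`, which `P` fixes, shows that all `p` classes have the
same weight. -/
theorem IsCyclic.sum_class_eq [NeZero p] (hP : IsCyclic P c M) (hrow : ∀ i, ∑ j, P i j = 1)
    {w : ι → ℝ} (hw : ∀ j, ∑ i, w i * P i j = w j) (hw1 : ∑ i, w i = 1) (r : ZMod p) :
    ∑ i with c i = r, w i = (p : ℝ)⁻¹ := by
  have h1 : ∀ r s : ZMod p, ∑ i with c i = r, w i = ∑ i with c i = s, w i := by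
    intro r s
    have := hP.sum_class_pow_mulVec hw 1 (s - r).val r
    rw [ZMod.natCast_zmod_val, add_sub_cancel] at this
    have e : (P ^ (s - r).val) *ᵥ (1 : ι → ℝ) = 1 := by
      ext i
      simpa [mulVec, dotProduct] using sum_pow_apply_eq_one hrow _ i
    rw [e] at this
    simpa using this
  have h2 : ∑ s : ZMod p, ∑ i with c i = s, w i = 1 := by
    rw [← hw1]
    exact Finset.sum_fiberwise _ _ _
  rw [Finset.sum_congr rfl fun s _ => h1 s r, Finset.sum_const, Finset.card_univ, ZMod.card,
    nsmul_eq_mul] at h2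
  exact eq_inv_of_mul_eq_one_right h2

/-- For large `k` the function `P ^ k *ᵥ f` is nearly constant on the class of `i`, hence close to
its `w`-mean there. The class has weight `1 / p`, and stationarity rewrites the mean as a sum of `f`
over the class `k` steps later. -/
theorem IsCyclic.tendsto_pow_mulVec [Nonempty ι] [NeZero p] (hP : IsCyclic P c M)
    (hrow : ∀ i, ∑ j, P i j = 1) {w : ι → ℝ} (hw0 : ∀ i, 0 ≤ w i)
    (hw : ∀ j, ∑ i, w i * P i j = w j) (hw1 : ∑ i, w i = 1) (f : ι → ℝ) (i : ι) :
    Tendsto (fun k : ℕ => ((P ^ k) *ᵥ f) i - p * ∑ j with c j = c i + k, w j * f j)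
      atTop (𝓝 0) := by
  rw [Metric.tendsto_atTop]
  intro ε hε
  obtain ⟨K, hK⟩ := hP.exists_classOscLE hrow f (half_pos hε)
  refine ⟨K, fun k hk => ?_⟩
  have hp0 : (p : ℝ) ≠ 0 := Nat.cast_ne_zero.2 (NeZero.ne p)
  have hpp : 0 < (p : ℝ) := Nat.cast_pos.2 (NeZero.pos p)
  have hcl := hP.sum_class_eq hrow hw hw1 (c i)
  have e : ((P ^ k) *ᵥ f) i - p * ∑ j with c j = c i + k, w j * f j =
      p * ∑ i' with c i' = c i, w i' * (((P ^ k) *ᵥ f) i - ((P ^ k) *ᵥ f) i') := by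
    rw [← hP.sum_class_pow_mulVec hw]
    simp_rw [mul_sub, Finset.sum_sub_distrib, ← Finset.sum_mul, hcl]
    field_simp
  rw [dist_zero_right, e, Real.norm_eq_abs, abs_mul, abs_of_pos hpp]
  have h2 : |∑ i' with c i' = c i, w i' * (((P ^ k) *ᵥ f) i - ((P ^ k) *ᵥ f) i')| ≤
      ∑ i' with c i' = c i, w i' * (ε / 2) := by
    refine (Finset.abs_sum_le_sum_abs _ _).trans (Finset.sum_le_sum fun i' hi' => ?_)
    rw [abs_mul, abs_of_nonneg (hw0 i')]
    have hc := (Finset.mem_filter.1 hi').2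
    refine mul_le_mul_of_nonneg_left (abs_le.2 ⟨?_, hK k hk _ _ hc.symm⟩) (hw0 i')
    have := hK k hk _ _ hc
    linarith
  rw [← Finset.sum_mul, hcl] at h2
  calc _ ≤ (p : ℝ) * ((p : ℝ)⁻¹ * (ε / 2)) := mul_le_mul_of_nonneg_left h2 hpp.le
    _ = ε / 2 := by field_simp
    _ < ε := by linarith

end Stochastic

end Cyclic

/-! ### Asymptotics of row sums of powers, and averaged ratios. -/

section Asymptotics

open Matrix

variable {ι : Type*} [Fintype ι] [DecidableEq ι] {A : Matrix ι ι ℝ}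

/-- The sum of the entries in a row of a power of `A`. -/
def rowSum (A : Matrix ι ι ℝ) (k : ℕ) (i : ι) : ℝ := ∑ j, (A ^ k) i j

/-- The stochastic matrix obtained from `A` by means of a positive right eigenvector. -/
def parryMatrix (A : Matrix ι ι ℝ) (t : ℝ) (v : ι → ℝ) : Matrix ι ι ℝ :=
  of fun i j => A i j * v j / (t * v i)

variable {t : ℝ} {u v : ι → ℝ} {p : ℕ} {c : ι → ZMod p} {M : ℕ}

/-- `parryMatrix` is `A / t` conjugated by the diagonal matrix of `v`, and so are the powers. -/
theorem IsPositiveEigenTriple.parryMatrix_pow_apply (h : IsPositiveEigenTriple A t u v) (k : ℕ)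
    (i j : ι) : (parryMatrix A t v ^ k) i j = (A ^ k) i j * v j / (t ^ k * v i) := by
  have ht := h.pos.ne'
  have hv := fun i => (h.right_pos i).ne'
  induction k generalizing j with
  | zero =>
    rcases eq_or_ne i j with rfl | hij
    · simp [hv]
    · simp [one_apply_ne hij]
  | succ k ih =>
    rw [pow_succ, mul_apply, pow_succ, mul_apply, Finset.sum_mul, Finset.sum_div]
    refine Finset.sum_congr rfl fun l _ => ?_
    rw [ih, parryMatrix, of_apply]
    have := hv l
    have := hv i
    field_simp
    ring

theorem IsPositiveEigenTriple.sum_parryMatrix (h : IsPositiveEigenTriple A t u v) (i : ι) :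
    ∑ j, parryMatrix A t v i j = 1 := by
  simp_rw [parryMatrix, of_apply]
  rw [← Finset.sum_div, h.sum_right, div_self (mul_pos h.pos (h.right_pos i)).ne']

theorem IsPositiveEigenTriple.sum_mul_parryMatrix (h : IsPositiveEigenTriple A t u v) (j : ι) :
    ∑ i, u i * v i * parryMatrix A t v i j = u j * v j := by
  have ht := h.pos.ne'
  have e : ∀ i, u i * v i * parryMatrix A t v i j = u i * A i j * (v j / t) := by
    intro i
    have := (h.right_pos i).ne'
    rw [parryMatrix, of_apply]
    field_simp
  simp_rw [e, ← Finset.sum_mul, h.sum_left]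
  field_simp

theorem IsPositiveEigenTriple.isCyclic_parryMatrix (h : IsPositiveEigenTriple A t u v)
    (hc : IsCyclic A c M) : IsCyclic (parryMatrix A t v) c M where
  nonneg i j := div_nonneg (mul_nonneg (hc.nonneg i j) (h.right_pos j).le)
    (mul_pos h.pos (h.right_pos i)).le
  step i j hij := hc.step i j <| (hc.nonneg i j).lt_of_ne fun h0 => by
    simp [parryMatrix, ← h0] at hij
  pow_pos m hm i j hij := by
    rw [h.parryMatrix_pow_apply]
    exact div_pos (mul_pos (hc.pow_pos m hm i j hij) (h.right_pos j))
      (mul_pos (pow_pos h.pos _) (h.right_pos i))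

/-- Apply the convergence for the Parry matrix to `f = 1 / v` with stationary weights `u * v`: `v i`
times the value of `P ^ k *ᵥ f` at `i` is `rowSum A k i / t ^ k`. -/
theorem IsPositiveEigenTriple.tendsto_rowSum [Nonempty ι] [NeZero p]
    (h : IsPositiveEigenTriple A t u v) (hc : IsCyclic A c M) (i : ι) :
    Tendsto (fun k : ℕ => rowSum A k i / t ^ k - p * v i * ∑ j with c j = c i + k, u j)
      atTop (𝓝 0) := by
  have := (h.isCyclic_parryMatrix hc).tendsto_pow_mulVec h.sum_parryMatrix
    (w := fun i => u i * v i) (fun i => (mul_pos (h.left_pos i) (h.right_pos i)).le)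
    h.sum_mul_parryMatrix h.dot_eq (fun i => (v i)⁻¹) i
  have hv := fun i => (h.right_pos i).ne'
  replace this := this.const_mul (v i)
  rw [mul_zero] at this
  refine this.congr fun k => ?_
  have hk := (pow_pos h.pos k).ne'
  rw [mul_sub]
  congr 1
  · rw [mulVec, dotProduct, Finset.mul_sum, rowSum, Finset.sum_div]
    refine Finset.sum_congr rfl fun j _ => ?_
    rw [h.parryMatrix_pow_apply]
    have := hv i
    have := hv j
    field_simp
  · have e : ∀ j, u j * v j * (v j)⁻¹ = u j := fun j => mul_inv_cancel_right₀ (hv j) _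
    simp_rw [e]
    ring

/-- Since `A ^ k *ᵥ v = t ^ k • v`, it suffices to compare the constant vector with `v` by means of
the extreme entries of `v`. The lower bound also keeps the denominators in `tendsto_average` away
from zero. -/
theorem IsPositiveEigenTriple.exists_rowSum_bounds [Nonempty ι] (hA : ∀ i j, 0 ≤ A i j)
    (h : IsPositiveEigenTriple A t u v) :
    ∃ a b : ℝ, 0 < a ∧ 0 < b ∧ ∀ k,
      a * t ^ k ≤ ∑ i, rowSum A k i ∧ ∑ i, rowSum A k i ≤ b * t ^ k := by
  obtain ⟨x, hx⟩ := Finite.exists_max v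
  obtain ⟨y, hy⟩ := Finite.exists_min v
  have hs : 0 < ∑ i, v i := Finset.sum_pos (fun i _ => h.right_pos i) Finset.univ_nonempty
  have e : ∀ k, ∑ i, ∑ j, (A ^ k) i j * v j = (∑ i, v i) * t ^ k := by
    intro k
    rw [Finset.sum_mul]
    refine Finset.sum_congr rfl fun i _ => ?_
    have := congrFun (pow_mulVec_eigenvector h.right_eq k) i
    rw [Pi.smul_apply, smul_eq_mul, mul_comm] at this
    exact this
  refine ⟨(∑ i, v i) / v x, (∑ i, v i) / v y, div_pos hs (h.right_pos x),
    div_pos hs (h.right_pos y), fun k => ⟨?_, ?_⟩⟩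
  · rw [div_mul_eq_mul_div, div_le_iff₀ (h.right_pos x), ← e]
    simp_rw [rowSum, Finset.sum_mul]
    exact Finset.sum_le_sum fun i _ => Finset.sum_le_sum fun j _ =>
      mul_le_mul_of_nonneg_left (hx j) (pow_apply_nonneg hA k i j)
  · rw [div_mul_eq_mul_div, le_div_iff₀ (h.right_pos y), ← e]
    simp_rw [rowSum, Finset.sum_mul]
    exact Finset.sum_le_sum fun i _ => Finset.sum_le_sum fun j _ =>
      mul_le_mul_of_nonneg_left (hy j) (pow_apply_nonneg hA k i j)

/-- A product rule for factors that need not converge but approach bounded, here periodic, ones. -/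
theorem tendsto_mul_sub_mul_zero {κ : Type*} {l : Filter κ} {a a' b b' : κ → ℝ} {C D : ℝ}
    (ha : Tendsto (fun q => a q - a' q) l (𝓝 0)) (hb : Tendsto (fun q => b q - b' q) l (𝓝 0))
    (ha' : ∀ q, |a' q| ≤ C) (hb' : ∀ q, |b' q| ≤ D) :
    Tendsto (fun q => a q * b q - a' q * b' q) l (𝓝 0) := by
  have h1 : Tendsto (fun q => a' q * (b q - b' q)) l (𝓝 0) :=
    bdd_le_mul_tendsto_zero' C (Eventually.of_forall ha') hb
  have h2 : Tendsto (fun q => b' q * (a q - a' q)) l (𝓝 0) :=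
    bdd_le_mul_tendsto_zero' D (Eventually.of_forall hb') ha
  have h3 := ((ha.mul hb).add h1).add h2
  simp only [mul_zero, add_zero] at h3
  exact h3.congr fun q => by ring

/-- This is why averaging over `p` positions removes the dependence on the cyclic classes. -/
theorem sum_range_zmod [NeZero p] (f : ZMod p → ℝ) (s : ZMod p) :
    ∑ j ∈ Finset.range p, f (s + j) = ∑ r, f r := by
  refine Finset.sum_bij (fun j _ => s + (j : ZMod p)) (by simp) ?_ ?_ (by simp)
  · intro a ha b hb hab
    have h := add_left_cancel hab
    rw [ZMod.natCast_eq_natCast_iff'] at h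
    rwa [Nat.mod_eq_of_lt (Finset.mem_range.1 ha), Nat.mod_eq_of_lt (Finset.mem_range.1 hb)] at h
  · intro r _
    exact ⟨(r - s).val, Finset.mem_range.2 (ZMod.val_lt _), by simp⟩

/-- The averaged ratios of the numbers of paths through a given path and of all paths converge. -/
theorem IsPositiveEigenTriple.tendsto_average [Nonempty ι] [NeZero p]
    (h : IsPositiveEigenTriple A t u v) (hc : IsCyclic A c M) (a b : ι) (n : ℕ)
    (hab : c b = c a + n) :
    Tendsto (fun q : ℕ × ℕ => (1 / (p : ℝ)) * ∑ j ∈ Finset.range p,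
        rowSum Aᵀ (q.1 - j) a * rowSum A (q.2 + j) b / ∑ i, rowSum A (n + q.1 + q.2) i)
      atTop (𝓝 (u a * v b / t ^ n)) := by
  have hp : (p : ℝ) ≠ 0 := Nat.cast_ne_zero.2 (NeZero.ne p)
  have ht := h.pos
  set V : ZMod p → ℝ := fun r => ∑ j with c j = r, v j with hV
  set U : ZMod p → ℝ := fun r => ∑ j with c j = r, u j with hU
  have hx : Tendsto (fun k : ℕ => rowSum Aᵀ k a / t ^ k - p * u a * V (c a - k)) atTop (𝓝 0) := by
    refine (h.transpose.tendsto_rowSum hc.transpose a).congr fun k => ?_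
    have e : ∀ j, (-c j = -c a + k) ↔ (c j = c a - k) := fun j =>
      ⟨fun h => by linear_combination -h, fun h => by linear_combination -h⟩
    simp_rw [e]
    rfl
  have hy : Tendsto (fun k : ℕ => rowSum A k b / t ^ k - p * v b * U (c b + k)) atTop (𝓝 0) :=
    h.tendsto_rowSum hc b
  have hz : Tendsto (fun k : ℕ => (∑ i, rowSum A k i) / t ^ k - p * ∑ r, V r * U (r + k))
      atTop (𝓝 0) := by
    have := tendsto_finsetSum Finset.univ fun i _ => h.tendsto_rowSum hc i
    simp only [Finset.sum_const_zero] at this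
    refine this.congr fun k => ?_
    rw [Finset.sum_sub_distrib, Finset.sum_div]
    congr 1
    simp_rw [hV, Finset.sum_mul, Finset.sum_filter]
    rw [Finset.sum_comm, Finset.mul_sum]
    refine Finset.sum_congr rfl fun i _ => ?_
    simp [hU, Finset.sum_filter, mul_assoc]
  obtain ⟨CV, hCV⟩ : ∃ C, ∀ r, |p * u a * V r| ≤ C := by
    obtain ⟨r, hr⟩ := Finite.exists_max fun r => |p * u a * V r|
    exact ⟨_, hr⟩
  obtain ⟨CU, hCU⟩ : ∃ C, ∀ r, |p * v b * U r| ≤ C := by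
    obtain ⟨r, hr⟩ := Finite.exists_max fun r => |p * v b * U r|
    exact ⟨_, hr⟩
  have tfst : ∀ j, Tendsto (fun q : ℕ × ℕ => q.1 - j) atTop atTop := fun j => by
    rw [← prod_atTop_atTop_eq]
    exact (tendsto_sub_atTop_nat j).comp tendsto_fst
  have tsnd : ∀ j, Tendsto (fun q : ℕ × ℕ => q.2 + j) atTop atTop := fun j => by
    rw [← prod_atTop_atTop_eq]
    exact (tendsto_add_atTop_nat j).comp tendsto_snd
  have tsum : Tendsto (fun q : ℕ × ℕ => n + q.1 + q.2) atTop atTop := by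
    refine tendsto_atTop_mono (fun q => ?_) (tsnd 0)
    simp
  have hxy := fun j => tendsto_mul_sub_mul_zero (hx.comp (tfst j)) (hy.comp (tsnd j))
    (a' := fun q : ℕ × ℕ => p * u a * V (c a - (q.1 - j : ℕ)))
    (b' := fun q : ℕ × ℕ => p * v b * U (c b + (q.2 + j : ℕ)))
    (fun q => hCV _) (fun q => hCU _)
  have hnum := (tendsto_finsetSum (Finset.range p) fun j _ => hxy j).const_mul (1 / (p : ℝ))
  have hdiff := hnum.sub ((hz.comp tsum).const_mul (u a * v b))
  simp only [Finset.sum_const_zero, mul_zero, sub_zero, Function.comp_apply] at hdiff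
  obtain ⟨δ, _, hδ, -, hbd⟩ := h.exists_rowSum_bounds hc.nonneg
  -- The ratio minus its claimed limit is the null sequence `hdiff` times this factor, which is
  -- bounded by the lower bound `δ` for the rescaled totals.
  have hinv := bdd_le_mul_tendsto_zero' (f := fun q : ℕ × ℕ =>
      (t ^ n * ((∑ i, rowSum A (n + q.1 + q.2) i) / t ^ (n + q.1 + q.2)))⁻¹)
    (t ^ n * δ)⁻¹ (Eventually.of_forall fun q => by
      have h1 : δ ≤ (∑ i, rowSum A (n + q.1 + q.2) i) / t ^ (n + q.1 + q.2) :=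
        (le_div_iff₀ (pow_pos ht _)).2 (hbd _).1
      have h2 : t ^ n * δ ≤
          t ^ n * ((∑ i, rowSum A (n + q.1 + q.2) i) / t ^ (n + q.1 + q.2)) := by gcongr
      have h3 : 0 < t ^ n * δ := by positivity
      rw [abs_of_pos (inv_pos.2 (h3.trans_le h2))]
      exact inv_anti₀ h3 h2) hdiff
  rw [tendsto_iff_norm_sub_tendsto_zero]
  refine (tendsto_norm_zero.comp hinv).congr' ?_
  -- From `q.1 ≥ p` on, the truncated differences `q.1 - j` are the true ones.
  filter_upwards [eventually_ge_atTop (p, 0)] with q hq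
  simp only [Function.comp_apply]
  congr 1
  have hW : 0 < ∑ i, rowSum A (n + q.1 + q.2) i :=
    lt_of_lt_of_le (mul_pos hδ (pow_pos ht _)) (hbd _).1
  set W := ∑ i, rowSum A (n + q.1 + q.2) i with hWd
  -- The periodic models match exactly: with `r = c a - q.1 + j`, the ends lie in the classes `r`
  -- and `r + (n + q.1 + q.2)`, and `r` runs through all residues.
  have hmain : (1 / (p : ℝ)) * ∑ j ∈ Finset.range p,
      p * u a * V (c a - (q.1 - j : ℕ)) * (p * v b * U (c b + (q.2 + j : ℕ))) =
      u a * v b * (p * ∑ r, V r * U (r + (n + q.1 + q.2 : ℕ))) := by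
    rw [← sum_range_zmod (fun r => V r * U (r + (n + q.1 + q.2 : ℕ))) (c a - q.1)]
    rw [Finset.mul_sum, Finset.mul_sum, Finset.mul_sum]
    refine Finset.sum_congr rfl fun j hj => ?_
    have hj' : j ≤ q.1 := (Finset.mem_range.1 hj).le.trans hq.1
    have e1 : c a - ((q.1 - j : ℕ) : ZMod p) = c a - q.1 + j := by
      rw [Nat.cast_sub hj']; ring
    have e2 : c b + ((q.2 + j : ℕ) : ZMod p) = c a - q.1 + j + (n + q.1 + q.2 : ℕ) := by
      rw [hab]; push_cast; ring
    rw [e1, e2]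
    field_simp
  have hsplit : (1 / (p : ℝ)) * ∑ j ∈ Finset.range p,
      (rowSum Aᵀ (q.1 - j) a / t ^ (q.1 - j) * (rowSum A (q.2 + j) b / t ^ (q.2 + j)) -
        p * u a * V (c a - (q.1 - j : ℕ)) * (p * v b * U (c b + (q.2 + j : ℕ)))) =
      (1 / (p : ℝ)) * (∑ j ∈ Finset.range p, rowSum Aᵀ (q.1 - j) a * rowSum A (q.2 + j) b) /
        t ^ (q.1 + q.2) - u a * v b * (p * ∑ r, V r * U (r + (n + q.1 + q.2 : ℕ))) := by
    rw [Finset.sum_sub_distrib, mul_sub, hmain, mul_div_assoc, Finset.sum_div]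
    congr 2
    refine Finset.sum_congr rfl fun j hj => ?_
    have hj' : j ≤ q.1 := (Finset.mem_range.1 hj).le.trans hq.1
    rw [div_mul_div_comm, ← pow_add]
    congr 2
    omega
  rw [hsplit, ← Finset.sum_div]
  have e3 : t ^ (n + q.1 + q.2) = t ^ n * t ^ (q.1 + q.2) := by rw [add_assoc, pow_add]
  have h4 : t ^ n ≠ 0 := (pow_pos ht n).ne'
  have h5 : t ^ (q.1 + q.2) ≠ 0 := (pow_pos ht _).ne'
  rw [e3]
  field_simp
  ring

end Asymptotics

/-! ### Sums over paths -/

section Paths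

open Matrix

variable {ι : Type*} [Fintype ι] [DecidableEq ι] {A : Matrix ι ι ℝ}

/-- The product of the entries of `A` along a path. -/
def pathWeight (A : Matrix ι ι ℝ) {n : ℕ} (w : Fin (n + 1) → ι) : ℝ :=
  ∏ i : Fin n, A (w i.castSucc) (w i.succ)

theorem pathWeight_cons {n : ℕ} (a : ι) (w : Fin (n + 1) → ι) :
    pathWeight A (Fin.cons (α := fun _ => ι) a w) = A a (w 0) * pathWeight A w := by
  rw [pathWeight, Fin.prod_univ_succ]
  simp [pathWeight]

theorem pathWeight_snoc {n : ℕ} (w : Fin (n + 1) → ι) (b : ι) :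
    pathWeight A (Fin.snoc (α := fun _ => ι) w b) = pathWeight A w * A (w (Fin.last n)) b := by
  rw [pathWeight, Fin.prod_univ_castSucc]
  simp only [Fin.succ_castSucc, Fin.snoc_castSucc, Fin.succ_last, Fin.snoc_last]
  rfl

/-- The word `x` carries the word `w` after its first `k` letters. -/
def HasWindow {m n : ℕ} (k : ℕ) (w : Fin n → ι) (x : Fin m → ι) : Prop :=
  ∀ (j : Fin n) (h : k + j < m), x ⟨k + j, h⟩ = w j

theorem hasWindow_cons {m n k : ℕ} (hk : k < m) (a : ι) (w : Fin n → ι) (x : Fin m → ι) :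
    HasWindow k (Fin.cons (α := fun _ => ι) a w) x ↔ x ⟨k, hk⟩ = a ∧ HasWindow (k + 1) w x := by
  constructor
  · intro h
    refine ⟨h 0 (by simpa), fun j hj => ?_⟩
    have := h j.succ (by rw [Fin.val_succ]; omega)
    rw [Fin.cons_succ] at this
    rw [← this]
    congr 2
    rw [Fin.val_succ]
    omega
  · rintro ⟨h0, h⟩ j hj
    induction j using Fin.cases with
    | zero => simpa using h0
    | succ j =>
      rw [Fin.cons_succ]
      rw [Fin.val_succ] at hj
      rw [← h j (by omega)]
      congr 2
      rw [Fin.val_succ]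
      omega

theorem hasWindow_snoc {m n k : ℕ} (hk : k + n < m) (b : ι) (w : Fin n → ι) (x : Fin m → ι) :
    HasWindow k (Fin.snoc (α := fun _ => ι) w b) x ↔ x ⟨k + n, hk⟩ = b ∧ HasWindow k w x := by
  constructor
  · intro h
    refine ⟨?_, fun j hj => ?_⟩
    · have := h (Fin.last n) (by simpa)
      rwa [Fin.snoc_last] at this
    · have := h j.castSucc (by simpa)
      rwa [Fin.snoc_castSucc] at this
  · rintro ⟨h0, h⟩ j hj
    induction j using Fin.lastCases with
    | last => rw [Fin.snoc_last, ← h0]; rfl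
    | cast j =>
      rw [Fin.snoc_castSucc]
      exact h j (by simpa using hj)

open Classical in
theorem sum_hasWindow_cons {m n k : ℕ} (hk : k < m) (w : Fin n → ι) (g : (Fin m → ι) → ℝ) :
    ∑ x with HasWindow (k + 1) w x, g x =
      ∑ a, ∑ x with HasWindow k (Fin.cons (α := fun _ => ι) a w) x, g x := by
  simp_rw [Finset.sum_filter, hasWindow_cons hk]
  rw [Finset.sum_comm]
  refine Finset.sum_congr rfl fun x _ => ?_
  simp_rw [ite_and]
  simp

open Classical in
theorem sum_hasWindow_snoc {m n k : ℕ} (hk : k + n < m) (w : Fin n → ι) (g : (Fin m → ι) → ℝ) :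
    ∑ x with HasWindow k w x, g x =
      ∑ b, ∑ x with HasWindow k (Fin.snoc (α := fun _ => ι) w b) x, g x := by
  simp_rw [Finset.sum_filter, hasWindow_snoc hk]
  rw [Finset.sum_comm]
  refine Finset.sum_congr rfl fun x _ => ?_
  simp_rw [ite_and]
  simp

open Classical in
/-- The weighted number of paths with a prescribed segment. -/
theorem sum_paths_hasWindow (f h : ι → ℝ) (m k : ℕ) : ∀ (l n : ℕ) (w : Fin (n + 1) → ι),
    m = n + k + l →
    ∑ x : Fin (m + 1) → ι with HasWindow k w x, f (x 0) * pathWeight A x * h (x (Fin.last m)) =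
      (f ᵥ* A ^ k) (w 0) * pathWeight A w * (A ^ l *ᵥ h) (w (Fin.last n)) := by
  -- The total length `m` stays fixed while the word is arbitrary: each step turns a free letter
  -- next to the word into a further letter of it, until the word fills the path.
  induction k with
  | zero =>
    intro l
    induction l with
    | zero =>
      intro n w hm
      obtain rfl : m = n := by omega
      have : ∀ x : Fin (m + 1) → ι, HasWindow 0 w x ↔ x = w := by
        refine fun x => ⟨fun hx => funext fun j => ?_, fun hx j hj => ?_⟩
        · rw [← hx j (by omega)]
          congr 1
          ext
          simp
        · rw [hx]
          congr 1
          ext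
          simp
      simp_rw [this, Finset.sum_filter]
      simp
    | succ l ih =>
      intro n w hm
      rw [sum_hasWindow_snoc (by omega)]
      have e : ∀ b, ∑ x : Fin (m + 1) → ι with HasWindow 0 (Fin.snoc (α := fun _ => ι) w b) x,
          f (x 0) * pathWeight A x * h (x (Fin.last m)) =
          f (w 0) * pathWeight A w * (A (w (Fin.last n)) b * (A ^ l *ᵥ h) b) := by
        intro b
        rw [ih (n + 1) _ (by omega), pathWeight_snoc, Fin.snoc_last,
          show (0 : Fin (n + 1 + 1)) = Fin.castSucc 0 from rfl, Fin.snoc_castSucc]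
        simp only [pow_zero, vecMul_one]
        ring
      simp_rw [e]
      rw [← Finset.mul_sum, pow_succ', ← mulVec_mulVec]
      simp [mulVec, dotProduct]
  | succ k ih =>
    intro l n w hm
    rw [sum_hasWindow_cons (by omega)]
    have e : ∀ a, ∑ x : Fin (m + 1) → ι with HasWindow k (Fin.cons (α := fun _ => ι) a w) x,
        f (x 0) * pathWeight A x * h (x (Fin.last m)) =
        (f ᵥ* A ^ k) a * A a (w 0) * (pathWeight A w * (A ^ l *ᵥ h) (w (Fin.last n))) := by
      intro a
      rw [ih l (n + 1) _ (by omega), pathWeight_cons, Fin.cons_zero, ← Fin.succ_last,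
        Fin.cons_succ]
      ring
    simp_rw [e]
    rw [← Finset.sum_mul, pow_succ, ← vecMul_vecMul]
    simp [vecMul, dotProduct, mul_assoc]

theorem vecMul_pow_one (k : ℕ) (i : ι) : ((1 : ι → ℝ) ᵥ* A ^ k) i = rowSum Aᵀ k i := by
  simp [rowSum, vecMul, dotProduct, ← transpose_pow]

theorem pow_mulVec_one (k : ℕ) (i : ι) : (A ^ k *ᵥ (1 : ι → ℝ)) i = rowSum A k i := by
  simp [rowSum, mulVec, dotProduct]

theorem sum_eq_sum_hasWindow {m k : ℕ} (hk : k < m) (g : (Fin m → ι) → ℝ) :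
    ∑ x, g x = ∑ a : ι, open Classical in ∑ x with HasWindow k (fun _ : Fin 1 => a) x, g x := by
  classical
  have h : ∀ x : Fin m → ι, HasWindow k (Fin.elim0 : Fin 0 → ι) x := fun x j => j.elim0
  have := sum_hasWindow_snoc (k := k) (m := m) (by omega) (Fin.elim0 : Fin 0 → ι) g
  simp only [h, Finset.filter_true] at this
  rw [this]
  refine Finset.sum_congr rfl fun a _ => ?_
  congr! 2

theorem sum_pathWeight (m : ℕ) :
    ∑ x : Fin (m + 1) → ι, pathWeight A x = ∑ i, rowSum A m i := by
  classical
  rw [sum_eq_sum_hasWindow (k := 0) (by omega)]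
  refine Finset.sum_congr rfl fun a _ => ?_
  have := sum_paths_hasWindow (A := A) 1 1 m 0 m 0 (fun _ => a) (by omega)
  simp only [Pi.one_apply, one_mul, mul_one, pow_mulVec_one] at this
  rw [this]
  simp [pathWeight]

theorem pathWeight_nonneg (hA : ∀ i j, 0 ≤ A i j) {n : ℕ} (w : Fin (n + 1) → ι) :
    0 ≤ pathWeight A w := Finset.prod_nonneg fun _ _ => hA _ _

theorem pathWeight_eq_zero_or_one (hA : ∀ i j, A i j = 0 ∨ A i j = 1) {n : ℕ}
    (w : Fin (n + 1) → ι) : pathWeight A w = 0 ∨ pathWeight A w = 1 := by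
  by_cases h : ∃ i : Fin n, A (w i.castSucc) (w i.succ) = 0
  · obtain ⟨i, hi⟩ := h
    exact Or.inl (Finset.prod_eq_zero (Finset.mem_univ i) hi)
  · push Not at h
    exact Or.inr (Finset.prod_eq_one fun i _ => (hA _ _).resolve_left (h i))

theorem cyclic_class_last {p : ℕ} {c : ι → ZMod p} {M : ℕ} (hc : IsCyclic A c M) {n : ℕ}
    (w : Fin (n + 1) → ι) (hw : pathWeight A w ≠ 0) : c (w (Fin.last n)) = c (w 0) + n := by
  induction n with
  | zero => simp
  | succ n ih =>
    rw [← Fin.snoc_init_self w, pathWeight_snoc] at hw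
    have h1 := ih _ (left_ne_zero_of_mul hw)
    have h2 : 0 < A (Fin.init w (Fin.last n)) (w (Fin.last (n + 1))) :=
      (hc.nonneg _ _).lt_of_ne (Ne.symm (right_ne_zero_of_mul hw))
    have h3 := hc.step _ _ h2
    rw [h3, h1, show Fin.init w 0 = w 0 from rfl]
    push_cast
    ring

end Paths

/-! ### Windows and cylinders -/

section Windows

variable {N : ℕ} {X : Set (ℤ → Fin N)}

/-- The block of a point at the sites `-M, …, M`. -/
def window (X : Set (ℤ → Fin N)) (M : ℕ) (x : X) : Fin (2 * M + 1) → Fin N :=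
  fun j => x.1 (-M + (j : ℕ))

theorem measurable_coord (i : ℤ) : Measurable fun x : X => x.1 i :=
  (measurable_pi_apply i).comp measurable_subtype_coe

theorem measurable_window (M : ℕ) : Measurable (window X M) :=
  measurable_pi_lambda _ fun _ => measurable_coord _

theorem measurableSet_cylinder {n : ℕ} (α : ℤ) (w : Fin n → Fin N) :
    MeasurableSet (cylinder X α w) := by
  have : cylinder X α w = ⋂ j : Fin n, (fun x : X => x.1 (α + (j : ℕ))) ⁻¹' {w j} := by
    ext x
    simp [cylinder]
  rw [this]
  exact MeasurableSet.iInter fun j => measurable_coord _ (measurableSet_singleton _)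

theorem window_preimage_singleton (M : ℕ) (w : Fin (2 * M + 1) → Fin N) :
    window X M ⁻¹' {w} = cylinder X (-M) w := by
  ext x
  simp [window, cylinder, funext_iff]

/-- Blocks of a larger window determine those of a smaller one. -/
theorem exists_window_eq_comp {M M' : ℕ} (h : M ≤ M') :
    ∃ φ : (Fin (2 * M' + 1) → Fin N) → (Fin (2 * M + 1) → Fin N), window X M = φ ∘ window X M' := by
  refine ⟨fun w j => w ⟨M' - M + j, by omega⟩, ?_⟩
  ext x j
  simp only [window, Function.comp_apply]
  rw [show -(M' : ℤ) + ((M' - M + j : ℕ) : ℤ) = -M + (j : ℕ) by omega]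

/-- The sets that depend on finitely many coordinates. -/
def windowSets (X : Set (ℤ → Fin N)) : Set (Set X) :=
  {s | ∃ (M : ℕ) (S : Set (Fin (2 * M + 1) → Fin N)), s = window X M ⁻¹' S}

theorem windowSets_common {s t : Set X} (hs : s ∈ windowSets X) (ht : t ∈ windowSets X) :
    ∃ (M : ℕ) (S T : Set (Fin (2 * M + 1) → Fin N)),
      s = window X M ⁻¹' S ∧ t = window X M ⁻¹' T := by
  obtain ⟨M₁, S, rfl⟩ := hs
  obtain ⟨M₂, T, rfl⟩ := ht
  obtain ⟨φ, hφ⟩ := exists_window_eq_comp (X := X) (le_max_left M₁ M₂)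
  obtain ⟨ψ, hψ⟩ := exists_window_eq_comp (X := X) (le_max_right M₁ M₂)
  exact ⟨max M₁ M₂, φ ⁻¹' S, ψ ⁻¹' T, by rw [hφ, Set.preimage_comp], by rw [hψ, Set.preimage_comp]⟩

/-- The algebra serves the approximation of measurable sets; for the uniqueness of measures the
π-system suffices. -/
theorem isSetAlgebra_windowSets : IsSetAlgebra (windowSets X) where
  empty_mem := ⟨0, ∅, by simp⟩
  compl_mem := by
    rintro _ ⟨M, S, rfl⟩
    exact ⟨M, Sᶜ, by simp⟩
  union_mem := by
    intro s t hs ht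
    obtain ⟨M, S, T, rfl, rfl⟩ := windowSets_common hs ht
    exact ⟨M, S ∪ T, by simp⟩

theorem isPiSystem_windowSets : IsPiSystem (windowSets X) := by
  intro s hs t ht _
  obtain ⟨M, S, T, rfl, rfl⟩ := windowSets_common hs ht
  exact ⟨M, S ∩ T, by simp⟩

theorem generateFrom_windowSets :
    (inferInstance : MeasurableSpace X) = MeasurableSpace.generateFrom (windowSets X) := by
  apply le_antisymm
  · rw [show (inferInstance : MeasurableSpace X) =
      MeasurableSpace.comap Subtype.val MeasurableSpace.pi from rfl, MeasurableSpace.pi,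
      MeasurableSpace.comap_iSup]
    refine iSup_le fun i => ?_
    rw [MeasurableSpace.comap_comp]
    rintro _ ⟨S, -, rfl⟩
    -- The site `i` lies in the window of radius `|i|`, where it has the position `i + |i|`.
    refine MeasurableSpace.measurableSet_generateFrom
      ⟨i.natAbs, {w | w ⟨(i + i.natAbs).toNat, by omega⟩ ∈ S}, ?_⟩
    ext x
    simp only [Set.mem_preimage, Function.comp_apply, window, Set.mem_ofPred_eq]
    rw [Int.toNat_of_nonneg (by omega), show -(i.natAbs : ℤ) + (i + i.natAbs) = i by ring]
  · refine MeasurableSpace.generateFrom_le ?_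
    rintro _ ⟨M, S, rfl⟩
    exact measurable_window M (Set.toFinite S).measurableSet

/-- Probability measures are determined by their values on the cylinders. -/
theorem measure_ext_cylinder {μ ν : Measure X} [IsProbabilityMeasure μ] [IsProbabilityMeasure ν]
    (h : ∀ (n : ℕ) (w : Fin (n + 1) → Fin N) (α : ℤ),
      μ.real (cylinder X α w) = ν.real (cylinder X α w)) : μ = ν := by
  refine ext_of_generate_finite (windowSets X) generateFrom_windowSets isPiSystem_windowSets ?_
    (by simp)
  rintro _ ⟨M, S, rfl⟩
  rw [← measureReal_eq_measureReal_iff]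
  have e : ∀ m : Measure X, IsProbabilityMeasure m →
      m.real (window X M ⁻¹' S) = ∑ w ∈ (Set.toFinite S).toFinset, m.real (cylinder X (-M) w) := by
    intro m _
    simp_rw [← window_preimage_singleton]
    rw [sum_measureReal_preimage_singleton _ fun a _ => measurable_window M
      (measurableSet_singleton a)]
    simp
  rw [e μ inferInstance, e ν inferInstance]
  exact Finset.sum_congr rfl fun w _ => h _ w _

end Windows

/-! ### Existence of the Parry measure -/

section Existence

variable {N : ℕ} {A : Matrix (Fin N) (Fin N) ℝ} {t : ℝ} {u v : Fin N → ℝ}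

/-- The weight that the Parry measure gives to a word. -/
def parryWeight (A : Matrix (Fin N) (Fin N) ℝ) (t : ℝ) (u v : Fin N → ℝ) {n : ℕ}
    (w : Fin (n + 1) → Fin N) : ℝ :=
  u (w 0) * v (w (Fin.last n)) / t ^ n * pathWeight A w

theorem IsPositiveEigenTriple.parryWeight_nonneg (h : IsPositiveEigenTriple A t u v)
    (hA : ∀ i j, 0 ≤ A i j) {n : ℕ} (w : Fin (n + 1) → Fin N) : 0 ≤ parryWeight A t u v w :=
  mul_nonneg (div_nonneg (mul_pos (h.left_pos _) (h.right_pos _)).le (pow_pos h.pos n).le)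
    (pathWeight_nonneg hA w)

theorem vecMul_pow_eigenvector (h : IsPositiveEigenTriple A t u v) (k : ℕ) (i : Fin N) :
    (Matrix.vecMul u (A ^ k)) i = t ^ k * u i := by
  have := congrFun (pow_mulVec_eigenvector h.transpose.right_eq k) i
  rwa [← Matrix.transpose_pow, Matrix.mulVec_transpose, Pi.smul_apply, smul_eq_mul] at this

-- Kolmogorov consistency: summing over the free letters applies powers of `A` to `u` and `v`, and
-- the powers of `t` that appear cancel in the normalization.
open Classical in
theorem IsPositiveEigenTriple.sum_parryWeight_hasWindow (h : IsPositiveEigenTriple A t u v)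
    {m k n : ℕ} (hm : n + k ≤ m) (w : Fin (n + 1) → Fin N) :
    ∑ x : Fin (m + 1) → Fin N with HasWindow k w x, parryWeight A t u v x =
      parryWeight A t u v w := by
  obtain ⟨l, rfl⟩ := Nat.exists_eq_add_of_le hm
  have := sum_paths_hasWindow (A := A) u v (n + k + l) k l n w rfl
  rw [vecMul_pow_eigenvector h, pow_mulVec_eigenvector h.right_eq] at this
  have ht := h.pos.ne'
  simp only [parryWeight, Pi.smul_apply, smul_eq_mul] at this ⊢
  calc _ = (∑ x : Fin (n + k + l + 1) → Fin N with HasWindow k w x,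
        u (x 0) * pathWeight A x * v (x (Fin.last _))) / t ^ (n + k + l) := by
        rw [Finset.sum_div]
        exact Finset.sum_congr rfl fun x _ => by ring
    _ = _ := by
        rw [this, pow_add, pow_add]
        field_simp

theorem IsPositiveEigenTriple.sum_parryWeight (h : IsPositiveEigenTriple A t u v) (m : ℕ) :
    ∑ x : Fin (m + 1) → Fin N, parryWeight A t u v x = 1 := by
  rw [sum_eq_sum_hasWindow (k := 0) (by omega), ← h.dot_eq]
  refine Finset.sum_congr rfl fun a _ => ?_
  rw [h.sum_parryWeight_hasWindow (by omega)]
  simp [parryWeight, pathWeight]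

/-- The extension of a block at the sites `-M, …, M` by its end letters. -/
def extendBlock (M : ℕ) (x : Fin (2 * M + 1) → Fin N) (i : ℤ) : Fin N :=
  x ⟨min (i + M).toNat (2 * M), by omega⟩

/-- The cylinders in the full shift. -/
def fullCylinder {n : ℕ} (α : ℤ) (w : Fin n → Fin N) : Set (ℤ → Fin N) :=
  {x | ∀ j : Fin n, x (α + (j : ℕ)) = w j}

theorem extendBlock_mem_fullCylinder {M n : ℕ} {α : ℤ} (h1 : -M ≤ α) (h2 : α + n ≤ M)
    (w : Fin (n + 1) → Fin N) (x : Fin (2 * M + 1) → Fin N) :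
    extendBlock M x ∈ fullCylinder α w ↔ HasWindow (α + M).toNat w x := by
  have key : ∀ (j : Fin (n + 1)) (hj : (α + M).toNat + j < 2 * M + 1),
      extendBlock M x (α + (j : ℕ)) = x ⟨(α + M).toNat + j, hj⟩ := by
    intro j hj
    unfold extendBlock
    congr 2
    omega
  constructor
  · intro h j hj
    rw [← key j hj]
    exact h j
  · intro h j
    rw [key j (by omega)]
    exact h j (by omega)

theorem isClopen_fullCylinder {n : ℕ} (α : ℤ) (w : Fin n → Fin N) :
    IsClopen (fullCylinder α w) := by
  have : fullCylinder α w = ⋂ j : Fin n, (fun x : ℤ → Fin N => x (α + (j : ℕ))) ⁻¹' {w j} := by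
    ext x
    simp [fullCylinder]
  rw [this]
  exact isClopen_iInter_of_finite fun j => (isClopen_discrete _).preimage (continuous_apply _)

/-- The finite approximation of the Parry measure by point masses. -/
def blockMeasure (A : Matrix (Fin N) (Fin N) ℝ) (t : ℝ) (u v : Fin N → ℝ) (M : ℕ) :
    Measure (ℤ → Fin N) :=
  ∑ x : Fin (2 * M + 1) → Fin N,
    ENNReal.ofReal (parryWeight A t u v x) • Measure.dirac (extendBlock M x)

open Classical in
theorem IsPositiveEigenTriple.blockMeasure_apply (h : IsPositiveEigenTriple A t u v)
    (hA : ∀ i j, 0 ≤ A i j) (M : ℕ) {s : Set (ℤ → Fin N)} (hs : MeasurableSet s) :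
    blockMeasure A t u v M s =
      ENNReal.ofReal (∑ x with extendBlock M x ∈ s, parryWeight A t u v x) := by
  rw [ENNReal.ofReal_sum_of_nonneg fun x _ => h.parryWeight_nonneg hA x, Finset.sum_filter]
  simp only [blockMeasure, Measure.coe_finsetSum, Finset.sum_apply, Measure.smul_apply,
    smul_eq_mul, Measure.dirac_apply' _ hs]
  refine Finset.sum_congr rfl fun x _ => ?_
  by_cases hx : extendBlock M x ∈ s <;> simp [hx]

theorem IsPositiveEigenTriple.isProbabilityMeasure_blockMeasure
    (h : IsPositiveEigenTriple A t u v) (hA : ∀ i j, 0 ≤ A i j) (M : ℕ) :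
    IsProbabilityMeasure (blockMeasure A t u v M) := by
  refine ⟨?_⟩
  rw [h.blockMeasure_apply hA M MeasurableSet.univ]
  simp [h.sum_parryWeight]

/-- The probability measures on the compact full shift form a compact space, so the block measures
converge along an ultrafilter. A cylinder has the correct mass as soon as the block covers it, and
it is clopen, so the mass passes to the limit. -/
theorem IsPositiveEigenTriple.exists_full_measure (h : IsPositiveEigenTriple A t u v)
    (hA : ∀ i j, 0 ≤ A i j) :
    ∃ μ : Measure (ℤ → Fin N), IsProbabilityMeasure μ ∧
      ∀ (n : ℕ) (w : Fin (n + 1) → Fin N) (α : ℤ),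
        μ (fullCylinder α w) = ENNReal.ofReal (parryWeight A t u v w) := by
  classical
  set m : ℕ → ProbabilityMeasure (ℤ → Fin N) := fun M =>
    ⟨blockMeasure A t u v M, h.isProbabilityMeasure_blockMeasure hA M⟩ with hm
  obtain ⟨μ, -, hμ⟩ := isCompact_univ.ultrafilter_le_nhds
    ((hyperfilter ℕ).map m) (by simp)
  have ht : Tendsto m (hyperfilter ℕ) (𝓝 μ) := hμ
  refine ⟨μ, inferInstance, fun n w α => ?_⟩
  have h1 := ProbabilityMeasure.tendsto_measure_of_null_frontier_of_tendsto' ht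
    (E := fullCylinder α w) (by rw [(isClopen_fullCylinder α w).frontier_eq]; simp)
  refine tendsto_nhds_unique h1 (tendsto_const_nhds.congr' ?_)
  have h2 : ∀ᶠ M : ℕ in hyperfilter ℕ, α.natAbs + n ≤ M :=
    (Nat.hyperfilter_le_atTop) (eventually_ge_atTop _)
  filter_upwards [h2] with M hM
  simp only [hm, ProbabilityMeasure.coe_mk]
  rw [h.blockMeasure_apply hA M (isClopen_fullCylinder α w).isOpen.measurableSet]
  congr 1
  simp_rw [extendBlock_mem_fullCylinder (show -(M : ℤ) ≤ α by omega) (show α + n ≤ M by omega)]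
  exact (h.sum_parryWeight_hasWindow (by omega) w).symm

theorem measurableSet_sft (A : Matrix (Fin N) (Fin N) ℝ) : MeasurableSet (sft A) := by
  have : sft A = ⋂ i : ℤ, (fun x : ℤ → Fin N => (x i, x (i + 1))) ⁻¹' {q | A q.1 q.2 = 1} := by
    ext x
    simp [sft]
  rw [this]
  exact MeasurableSet.iInter fun i =>
    ((measurable_pi_apply i).prodMk (measurable_pi_apply (i + 1))) (Set.toFinite _).measurableSet

/-- The measure on the full shift is carried by `sft A`: the complement is a countable union of
cylinders of forbidden two-letter words, of weight zero. -/
theorem IsPositiveEigenTriple.exists_measure (h : IsPositiveEigenTriple A t u v)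
    (hA : ∀ i j, A i j = 0 ∨ A i j = 1) :
    ∃ μ : Measure (sft A), IsProbabilityMeasure μ ∧
      ∀ (n : ℕ) (w : Fin (n + 1) → Fin N) (α : ℤ),
        μ.real (cylinder (sft A) α w) = parryWeight A t u v w := by
  have hA0 : ∀ i j, 0 ≤ A i j := fun i j => by rcases hA i j with h | h <;> simp [h]
  obtain ⟨μ, hμ, hcyl⟩ := h.exists_full_measure hA0
  have hsft : ∀ᵐ x ∂μ, x ∈ sft A := by
    refine ae_all_iff.2 fun i => ?_
    rw [ae_iff]
    have hsub : {x : ℤ → Fin N | ¬ A (x i) (x (i + 1)) = 1} ⊆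
        ⋃ q : {q : Fin N × Fin N // ¬ A q.1 q.2 = 1}, fullCylinder i ![q.1.1, q.1.2] := by
      intro x hx
      refine Set.mem_iUnion.2 ⟨⟨(x i, x (i + 1)), hx⟩, fun j => ?_⟩
      fin_cases j <;> simp
    refine measure_mono_null hsub (measure_iUnion_null fun q => ?_)
    rw [hcyl 1]
    have := (hA q.1.1 q.1.2).resolve_right q.2
    simp [parryWeight, pathWeight, this]
  have hemb : MeasurableEmbedding (Subtype.val : sft A → ℤ → Fin N) :=
    MeasurableEmbedding.subtype_coe (measurableSet_sft A)
  refine ⟨μ.comap Subtype.val, ⟨?_⟩, fun n w α => ?_⟩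
  · rw [hemb.comap_apply, Set.image_univ, Subtype.range_coe, ← prob_compl_eq_zero_iff
      (measurableSet_sft A)]
    exact hsft
  · rw [measureReal_def, hemb.comap_apply]
    have e : Subtype.val '' cylinder (sft A) α w = fullCylinder α w ∩ sft A := by
      ext x
      constructor
      · rintro ⟨y, hy, rfl⟩
        exact ⟨hy, y.2⟩
      · rintro ⟨h1, h2⟩
        exact ⟨⟨x, h2⟩, h1, rfl⟩
    rw [e, Set.inter_comm, Measure.measure_inter_eq_of_ae hsft, hcyl,
      ENNReal.toReal_ofReal (h.parryWeight_nonneg hA0 w)]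

end Existence

/-! ### The shift map and its entropy -/

section Entropy

variable {N : ℕ} {A : Matrix (Fin N) (Fin N) ℝ} {μ : Measure (sft A)}

theorem measurable_shift : Measurable (shift A) :=
  Measurable.subtype_mk (measurable_pi_lambda _ fun i => measurable_coord (i + 1))

theorem shift_iterate_apply (n : ℕ) (x : sft A) (i : ℤ) : ((shift A)^[n] x).1 i = x.1 (i + n) := by
  induction n generalizing x with
  | zero => simp
  | succ n ih =>
    rw [Function.iterate_succ_apply, ih]
    simp only [shift]
    refine congrArg x.1 ?_
    push_cast
    ring

/-- The letter at the site `0`. -/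
def coordZero (A : Matrix (Fin N) (Fin N) ℝ) (x : sft A) : Fin N := x.1 0

theorem measurable_coordZero : Measurable (coordZero A) := measurable_coord 0

theorem itinerary_coordZero_apply (n : ℕ) (x : sft A) (j : Fin n) :
    itinerary (shift A) (coordZero A) n x j = x.1 (j : ℕ) := by
  simp [itinerary, coordZero, shift_iterate_apply]

theorem itinerary_coordZero_preimage {n : ℕ} (w : Fin n → Fin N) :
    itinerary (shift A) (coordZero A) n ⁻¹' {w} = cylinder (sft A) 0 w := by
  ext x
  simp [funext_iff, itinerary_coordZero_apply, cylinder]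

theorem shift_iterate_preimage_cylinder {n : ℕ} (m : ℕ) (α : ℤ) (w : Fin n → Fin N) :
    (shift A)^[m] ⁻¹' cylinder (sft A) α w = cylinder (sft A) (α + m) w := by
  ext x
  simp only [Set.mem_preimage, cylinder, Set.mem_ofPred_eq, shift_iterate_apply]
  refine forall_congr' fun j => ?_
  rw [add_right_comm]

theorem measureReal_cylinder_add (hμ : MeasurePreserving (shift A) μ μ) {n : ℕ} (m : ℕ) (α : ℤ)
    (w : Fin n → Fin N) : μ.real (cylinder (sft A) (α + m) w) = μ.real (cylinder (sft A) α w) := by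
  rw [← shift_iterate_preimage_cylinder,
    (hμ.iterate m).measureReal_preimage (measurableSet_cylinder α w).nullMeasurableSet]

theorem measureReal_cylinder_eq (hμ : MeasurePreserving (shift A) μ μ) {n : ℕ} (α : ℤ)
    (w : Fin n → Fin N) : μ.real (cylinder (sft A) α w) = μ.real (cylinder (sft A) 0 w) := by
  rcases le_total 0 α with h | h
  · have := measureReal_cylinder_add hμ α.toNat 0 w
    rwa [Int.toNat_of_nonneg h, zero_add] at this
  · have := measureReal_cylinder_add hμ (-α).toNat α w
    rwa [Int.toNat_of_nonneg (by omega), add_neg_cancel, eq_comm] at this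

/-- The itineraries of a function of a block of letters are determined by blocks of letters. -/
theorem fibreEntropy_itinerary_window_le [IsProbabilityMeasure μ]
    (hμ : MeasurePreserving (shift A) μ μ) {k M : ℕ} (γ : (Fin (2 * M + 1) → Fin N) → Fin k)
    (n : ℕ) :
    fibreEntropy μ (itinerary (shift A) (γ ∘ window (sft A) M) n) ≤
      fibreEntropy μ (itinerary (shift A) (coordZero A) (n + 2 * M)) := by
  have hg : Measurable (γ ∘ window (sft A) M) :=
    (measurable_of_finite γ).comp (measurable_window M)
  -- Shifting by `M` moves the sites involved from `-M, …, n - 1 + M` to `0, …, n + 2 * M - 1`.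
  rw [← fibreEntropy_comp_measurePreserving (hμ.iterate M)
    (measurable_itinerary measurable_shift hg n)]
  have e : itinerary (shift A) (γ ∘ window (sft A) M) n ∘ (shift A)^[M] =
      (fun (x : Fin (n + 2 * M) → Fin N) (i : Fin n) =>
        γ fun j : Fin (2 * M + 1) => x ⟨i + j, by omega⟩) ∘
      itinerary (shift A) (coordZero A) (n + 2 * M) := by
    ext1 x
    funext i
    simp only [Function.comp_apply, itinerary_coordZero_apply]
    simp only [itinerary, Function.comp_apply]
    congr 1
    funext j
    simp only [window, shift_iterate_apply]
    refine congrArg x.1 ?_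
    push_cast
    ring
  rw [e]
  exact fibreEntropy_comp_le (measurable_itinerary measurable_shift measurable_coordZero _) _

/-- Measurable functions with finitely many values are approximated in measure by functions of
finitely many coordinates. -/
theorem exists_window_approx {X : Set (ℤ → Fin N)} {m : Measure X} [IsProbabilityMeasure m] {k : ℕ}
    {f : X → Fin k} (hf : Measurable f) {ε : ℝ} (hε : 0 < ε) :
    ∃ (M : ℕ) (γ : (Fin (2 * M + 1) → Fin N) → Fin k),
      m.real {x | f x ≠ γ (window X M x)} ≤ ε := by
  obtain ⟨x₀⟩ : Nonempty X := m.nonempty_of_neZero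
  have hk : 0 < (k : ℝ) + 1 := by positivity
  have hd := Measure.MeasureDense.of_generateFrom_isSetAlgebra_finite (μ := m)
    isSetAlgebra_windowSets generateFrom_windowSets
  have h1 : ∀ a : Fin k, ∃ t ∈ windowSets X, m.real (symmDiff (f ⁻¹' {a}) t) ≤ ε / (k + 1) := by
    intro a
    obtain ⟨t, ht, hlt⟩ := hd.approx (f ⁻¹' {a}) (hf (measurableSet_singleton a))
      (measure_ne_top _ _) (ε / (k + 1)) (by positivity)
    refine ⟨t, ht, ?_⟩
    rw [measureReal_def]
    exact ENNReal.toReal_le_of_le_ofReal (by positivity) hlt.le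
  choose t ht hle using h1
  choose Ms S hS using ht
  obtain ⟨M, hM⟩ : ∃ M, ∀ a, Ms a ≤ M :=
    ⟨Finset.univ.sup Ms, fun a => Finset.le_sup (Finset.mem_univ a)⟩
  choose φ hφ using fun a => exists_window_eq_comp (X := X) (hM a)
  have htS : ∀ a x, x ∈ t a ↔ φ a (window X M x) ∈ S a := by
    intro a x
    rw [hS a, hφ a]
    rfl
  classical
  -- Outside the symmetric differences exactly one `a` qualifies, namely `f x`, so neither the
  -- choice nor the default value matters.
  refine ⟨M, fun w => if h : ∃ a, φ a w ∈ S a then h.choose else f x₀, ?_⟩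
  have hsub : {x | f x ≠ (fun w => if h : ∃ a, φ a w ∈ S a then h.choose else f x₀)
      (window X M x)} ⊆ ⋃ a, symmDiff (f ⁻¹' {a}) (t a) := by
    intro x hx
    by_contra hnot
    simp only [Set.mem_iUnion, not_exists, Set.mem_symmDiff, Set.mem_preimage,
      Set.mem_singleton_iff, not_or, not_and, not_not] at hnot
    have hiff : ∀ a, φ a (window X M x) ∈ S a ↔ f x = a := fun a => by
      rw [← htS]
      exact ⟨(hnot a).2, (hnot a).1⟩
    apply hx
    have hex : ∃ a, φ a (window X M x) ∈ S a := ⟨f x, (hiff _).2 rfl⟩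
    simp only [dif_pos hex]
    exact (hiff _).1 hex.choose_spec
  calc _ ≤ m.real (⋃ a, symmDiff (f ⁻¹' {a}) (t a)) := measureReal_mono hsub
    _ ≤ ∑ a, m.real (symmDiff (f ⁻¹' {a}) (t a)) := measureReal_iUnion_fintype_le _
    _ ≤ ∑ _a : Fin k, ε / (k + 1) := Finset.sum_le_sum fun a _ => hle a
    _ = k * (ε / (k + 1)) := by simp
    _ ≤ ε := by
      rw [mul_div_assoc', div_le_iff₀ hk]
      nlinarith

/-- The conditional entropy of a function with respect to a suitable function of finitely many
coordinates is small. -/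
theorem exists_window_condEntropy_lt {X : Set (ℤ → Fin N)} {m : Measure X}
    [IsProbabilityMeasure m] {k : ℕ} {f : X → Fin k} (hf : Measurable f) {ε : ℝ} (hε : 0 < ε) :
    ∃ (M : ℕ) (γ : (Fin (2 * M + 1) → Fin N) → Fin k),
      fibreEntropy m (fun x => (f x, (γ ∘ window X M) x)) - fibreEntropy m (γ ∘ window X M) <
        ε := by
  choose M γ hγ using fun j : ℕ =>
    exists_window_approx (m := m) hf (ε := 1 / ((j : ℝ) + 1)) (by positivity)
  have hδ : Tendsto (fun j : ℕ => 1 / ((j : ℝ) + 1)) atTop (𝓝 0) :=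
    tendsto_one_div_add_atTop_nhds_zero_nat
  set g : ℕ → X → Fin k := fun j => γ j ∘ window X (M j) with hg
  have hD : ∀ j, m.real {x | f x ≠ g j x} ≤ 1 / ((j : ℝ) + 1) := hγ
  have close : ∀ (s s' : Set X) (j : ℕ), (∀ x, f x = g j x → (x ∈ s ↔ x ∈ s')) →
      |m.real s - m.real s'| ≤ 1 / ((j : ℝ) + 1) := by
    intro s s' j h
    have aux : ∀ s s' : Set X, (∀ x, f x = g j x → (x ∈ s ↔ x ∈ s')) →
        m.real s ≤ m.real s' + 1 / ((j : ℝ) + 1) := by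
      intro s s' h
      have hsub : s ⊆ s' ∪ {x | f x ≠ g j x} := fun x hx => by
        by_cases hfx : f x = g j x
        · exact Or.inl ((h x hfx).1 hx)
        · exact Or.inr hfx
      exact (measureReal_mono hsub).trans ((measureReal_union_le _ _).trans
        (add_le_add_right (hD j) _))
    rw [abs_le]
    constructor
    · linarith [aux s' s fun x hx => (h x hx).symm]
    · linarith [aux s s' h]
  have lim : ∀ (s : ℕ → Set X) (s' : Set X), (∀ j x, f x = g j x → (x ∈ s j ↔ x ∈ s')) →
      Tendsto (fun j => Real.negMulLog (m.real (s j))) atTop (𝓝 (Real.negMulLog (m.real s'))) := by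
    intro s s' h
    refine (Real.continuous_negMulLog.tendsto _).comp ?_
    rw [tendsto_iff_norm_sub_tendsto_zero]
    exact squeeze_zero (fun j => norm_nonneg _) (fun j => close _ _ j (h j)) hδ
  -- As `g j` tends to `f` in measure, the joint entropy tends to that of `(f, f)`, which is the
  -- entropy of `f`, and so does the entropy of `g j`; the difference vanishes in the limit.
  have h1 : Tendsto (fun j => fibreEntropy m (fun x => (f x, g j x))) atTop
      (𝓝 (fibreEntropy m (fun x => (f x, f x)))) := by
    refine tendsto_finsetSum _ fun a _ => lim _ _ fun j x hx => ?_
    simp [hx]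
  have h2 : Tendsto (fun j => fibreEntropy m (g j)) atTop (𝓝 (fibreEntropy m f)) := by
    refine tendsto_finsetSum _ fun a _ => lim _ _ fun j x hx => ?_
    simp [hx]
  have h3 : fibreEntropy m (fun x => (f x, f x)) = fibreEntropy m f :=
    fibreEntropy_congr (hf.prodMk hf) hf Prod.fst (fun a => (a, a)) rfl rfl
  have h4 := h1.sub h2
  rw [h3, sub_self] at h4
  obtain ⟨j, hj⟩ := (h4.eventually (gt_mem_nhds hε)).exists
  exact ⟨M j, γ j, hj⟩

theorem EReal_limsup_div_le {a : ℕ → ℝ} {d C : ℝ} (h : ∀ n, a n ≤ n * d + C) :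
    limsup (fun n : ℕ => ((a n / (n : ℝ) : ℝ) : EReal)) atTop ≤ (d : EReal) := by
  have h1 : Tendsto (fun n : ℕ => ((d + C / n : ℝ) : EReal)) atTop (𝓝 (d : EReal)) := by
    refine (continuous_coe_real_ereal.tendsto _).comp ?_
    simpa using (tendsto_const_div_atTop_nhds_zero_nat C).const_add d
  rw [← h1.limsup_eq]
  refine limsup_le_limsup ?_
  filter_upwards [eventually_gt_atTop 0] with n hn
  have hn' : (0 : ℝ) < n := Nat.cast_pos.2 hn
  rw [EReal.coe_le_coe_iff, div_le_iff₀ hn', add_mul, div_mul_cancel₀ _ hn'.ne']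
  linarith [h n]

theorem le_EReal_limsup_div {a : ℕ → ℝ} {d C : ℝ} (h : ∀ n, n * d - C ≤ a n) :
    (d : EReal) ≤ limsup (fun n : ℕ => ((a n / (n : ℝ) : ℝ) : EReal)) atTop := by
  have h1 : Tendsto (fun n : ℕ => ((d - C / n : ℝ) : EReal)) atTop (𝓝 (d : EReal)) := by
    refine (continuous_coe_real_ereal.tendsto _).comp ?_
    simpa using (tendsto_const_div_atTop_nhds_zero_nat C).const_sub d
  rw [← h1.limsup_eq]
  refine limsup_le_limsup ?_
  filter_upwards [eventually_gt_atTop 0] with n hn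
  have hn' : (0 : ℝ) < n := Nat.cast_pos.2 hn
  rw [EReal.coe_le_coe_iff, le_div_iff₀ hn', sub_mul, div_mul_cancel₀ _ hn'.ne']
  linarith [h n]

/-- The Kolmogorov-Sinai theorem for the partition according to the letter at the site `0`, in the
form of an upper bound for the entropy. -/
theorem measureEntropy_le [IsProbabilityMeasure μ] (hμ : MeasurePreserving (shift A) μ μ)
    {d C : ℝ} (h : ∀ n : ℕ, fibreEntropy μ (itinerary (shift A) (coordZero A) n) ≤ n * d + C) :
    measureEntropy (shift A) μ ≤ (d : EReal) := by
  refine iSup_le fun k => iSup_le fun f => iSup_le fun hf => ?_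
  simp_rw [joinEntropy_eq]
  refine EReal.le_of_forall_lt_iff_le.1 fun z hz => ?_
  have hε : 0 < z - d := sub_pos.2 (EReal.coe_lt_coe_iff.1 hz)
  obtain ⟨M, γ, hγ⟩ := exists_window_condEntropy_lt (m := μ) hf hε
  -- The itinerary of `f` costs `(n + 2 * M) * d + C` for the block of letters and `n * (z - d)` for
  -- the conditional entropies: in all `n * z` and a constant.
  refine EReal_limsup_div_le (C := 2 * M * d + C) fun n => ?_
  have h1 := fibreEntropy_itinerary_le (m := μ) hμ hf
    ((measurable_of_finite γ).comp (measurable_window M)) n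
  have h2 := fibreEntropy_itinerary_window_le hμ γ n
  have h3 := h (n + 2 * M)
  have h4 := mul_le_mul_of_nonneg_left hγ.le (Nat.cast_nonneg (α := ℝ) n)
  push_cast at h3
  linarith

theorem le_measureEntropy [IsProbabilityMeasure μ] {d C : ℝ}
    (h : ∀ n : ℕ, n * d - C ≤ fibreEntropy μ (itinerary (shift A) (coordZero A) n)) :
    (d : EReal) ≤ measureEntropy (shift A) μ := by
  refine le_trans ?_ (le_iSup_of_le N (le_iSup_of_le (coordZero A)
    (le_iSup_of_le measurable_coordZero le_rfl)))
  simp_rw [joinEntropy_eq]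
  exact le_EReal_limsup_div h

end Entropy

/-! ### Uniqueness of the measure of maximal entropy -/

section Uniqueness

variable {N : ℕ} {A : Matrix (Fin N) (Fin N) ℝ} {t : ℝ} {u v : Fin N → ℝ} {ν : Measure (sft A)}

/-- The mass of a cylinder, continued by one letter according to the Parry transition matrix. -/
def continuedMass (ν : Measure (sft A)) (t : ℝ) (v : Fin N → ℝ) {n : ℕ}
    (x : Fin (n + 2) → Fin N) : ℝ :=
  ν.real (cylinder (sft A) 0 (Fin.init x)) *
    parryMatrix A t v (x (Fin.last n).castSucc) (x (Fin.last (n + 1)))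

theorem cylinder_subset_init {n : ℕ} (α : ℤ) (x : Fin (n + 1) → Fin N) :
    cylinder (sft A) α x ⊆ cylinder (sft A) α (Fin.init x) :=
  fun _ hy j => hy j.castSucc

theorem cylinder_eq_empty {n : ℕ} (α : ℤ) (x : Fin (n + 2) → Fin N)
    (h : A (x (Fin.last n).castSucc) (x (Fin.last (n + 1))) = 0) : cylinder (sft A) α x = ∅ := by
  refine Set.eq_empty_of_forall_notMem fun y hy => ?_
  have h1 := hy (Fin.last n).castSucc
  have h2 := hy (Fin.last (n + 1))
  have h3 := y.2 (α + n)
  simp only [Fin.val_castSucc, Fin.val_last] at h1 h2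
  rw [h1, show α + (n : ℤ) + 1 = α + ((n + 1 : ℕ) : ℤ) by push_cast; ring, h2, h] at h3
  exact zero_ne_one h3

theorem sum_measureReal_cylinder [IsProbabilityMeasure ν] (n : ℕ) :
    ∑ x : Fin n → Fin N, ν.real (cylinder (sft A) 0 x) = 1 := by
  simp_rw [← itinerary_coordZero_preimage]
  rw [sum_measureReal_fibre (measurable_itinerary measurable_shift measurable_coordZero n)]
  simp

theorem sum_snoc {n : ℕ} (g : (Fin (n + 1) → Fin N) → ℝ) :
    ∑ x, g x = ∑ w : Fin n → Fin N, ∑ b, g (Fin.snoc (α := fun _ => Fin N) w b) := by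
  rw [← (Fin.snocEquiv fun _ : Fin (n + 1) => Fin N).sum_comp, Fintype.sum_prod_type,
    Finset.sum_comm]
  rfl

theorem sum_continuedMass [IsProbabilityMeasure ν] (h : IsPositiveEigenTriple A t u v) (n : ℕ) :
    ∑ x : Fin (n + 2) → Fin N, continuedMass ν t v x = 1 := by
  rw [sum_snoc, ← sum_measureReal_cylinder (ν := ν) (n + 1)]
  refine Finset.sum_congr rfl fun w _ => ?_
  simp only [continuedMass, Fin.init_snoc, Fin.snoc_castSucc, Fin.snoc_last]
  rw [← Finset.mul_sum, h.sum_parryMatrix, mul_one]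

/-- The absolute continuity that Gibbs' inequality requires. -/
theorem measureReal_cylinder_eq_zero [IsProbabilityMeasure ν] (h : IsPositiveEigenTriple A t u v)
    {n : ℕ} (x : Fin (n + 2) → Fin N) (hx : continuedMass ν t v x = 0) :
    ν.real (cylinder (sft A) 0 x) = 0 := by
  rcases mul_eq_zero.1 hx with h0 | h0
  · exact le_antisymm (h0 ▸ measureReal_mono (cylinder_subset_init 0 x)) measureReal_nonneg
  · rw [parryMatrix, Matrix.of_apply, div_eq_zero_iff] at h0
    have h1 := h0.resolve_right (mul_pos h.pos (h.right_pos _)).ne'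
    rw [cylinder_eq_empty 0 x ((mul_eq_zero.1 h1).resolve_right (h.right_pos _).ne')]
    simp

theorem continuedMass_nonneg (hA : ∀ i j, 0 ≤ A i j) (h : IsPositiveEigenTriple A t u v) {n : ℕ}
    (x : Fin (n + 2) → Fin N) : 0 ≤ continuedMass ν t v x :=
  mul_nonneg measureReal_nonneg (div_nonneg (mul_nonneg (hA _ _) (h.right_pos _).le)
    (mul_pos h.pos (h.right_pos _)).le)

/-- The mean of a function of a letter does not depend on the site. -/
theorem sum_cylinder_mul_letter [IsProbabilityMeasure ν] (hν : MeasurePreserving (shift A) ν ν)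
    {n : ℕ} (j : Fin n) (g : Fin N → ℝ) :
    ∑ x : Fin n → Fin N, ν.real (cylinder (sft A) 0 x) * g (x j) =
      ∑ a, ν.real (coordZero A ⁻¹' {a}) * g a := by
  simp_rw [← itinerary_coordZero_preimage]
  rw [sum_measureReal_fibre_comp_mul
    (measurable_itinerary measurable_shift measurable_coordZero n) (fun x => x j) g]
  refine Finset.sum_congr rfl fun a _ => ?_
  congr 1
  rw [show (fun x : Fin n → Fin N => x j) ∘ itinerary (shift A) (coordZero A) n =
    coordZero A ∘ (shift A)^[j] from rfl, Set.preimage_comp,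
    (hν.iterate j).measureReal_preimage
      (measurable_coordZero (measurableSet_singleton a)).nullMeasurableSet]

/-- On allowed transitions the logarithm of the Parry probability from `a` to `b` is `log (v b) -
log (v a) - log t`. By invariance the two terms in `v` have equal means and cancel. -/
theorem neg_sum_mul_log_continuedMass [IsProbabilityMeasure ν]
    (hν : MeasurePreserving (shift A) ν ν) (hA : ∀ i j, A i j = 0 ∨ A i j = 1)
    (h : IsPositiveEigenTriple A t u v) (n : ℕ) :
    - ∑ x : Fin (n + 2) → Fin N, ν.real (cylinder (sft A) 0 x) * Real.log (continuedMass ν t v x) =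
      fibreEntropy ν (itinerary (shift A) (coordZero A) (n + 1)) + Real.log t := by
  have e : ∀ x : Fin (n + 2) → Fin N,
      ν.real (cylinder (sft A) 0 x) * Real.log (continuedMass ν t v x) =
      ν.real (cylinder (sft A) 0 x) * Real.log (ν.real (cylinder (sft A) 0 (Fin.init x))) +
      ν.real (cylinder (sft A) 0 x) * Real.log (v (x (Fin.last (n + 1)))) -
      ν.real (cylinder (sft A) 0 x) * Real.log (v (x (Fin.last n).castSucc)) -
      ν.real (cylinder (sft A) 0 x) * Real.log t := by
    intro x
    by_cases h0 : ν.real (cylinder (sft A) 0 x) = 0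
    · simp [h0]
    have hq : continuedMass ν t v x ≠ 0 := fun hq => h0 (measureReal_cylinder_eq_zero h x hq)
    have hi : ν.real (cylinder (sft A) 0 (Fin.init x)) ≠ 0 := left_ne_zero_of_mul hq
    have hA1 : A (x (Fin.last n).castSucc) (x (Fin.last (n + 1))) = 1 := by
      refine (hA _ _).resolve_left fun h0' => h0 ?_
      rw [cylinder_eq_empty 0 x h0']
      simp
    rw [continuedMass, parryMatrix, Matrix.of_apply, hA1, one_mul, Real.log_mul hi
      (div_pos (h.right_pos _) (mul_pos h.pos (h.right_pos _))).ne',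
      Real.log_div (h.right_pos _).ne' (mul_pos h.pos (h.right_pos _)).ne',
      Real.log_mul h.pos.ne' (h.right_pos _).ne']
    ring
  simp_rw [e, Finset.sum_sub_distrib, Finset.sum_add_distrib]
  rw [sum_cylinder_mul_letter hν (Fin.last (n + 1)) fun a => Real.log (v a),
    sum_cylinder_mul_letter hν (Fin.last n).castSucc fun a => Real.log (v a), ← Finset.sum_mul,
    sum_measureReal_cylinder]
  have e2 : ∑ x : Fin (n + 2) → Fin N, ν.real (cylinder (sft A) 0 x) *
      Real.log (ν.real (cylinder (sft A) 0 (Fin.init x))) =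
      - fibreEntropy ν (itinerary (shift A) (coordZero A) (n + 1)) := by
    simp_rw [← itinerary_coordZero_preimage]
    rw [sum_measureReal_fibre_comp_mul
      (measurable_itinerary measurable_shift measurable_coordZero (n + 2))
      (fun x : Fin (n + 2) → Fin N => (Fin.init x : Fin (n + 1) → Fin N))
      (fun w => Real.log (ν.real (itinerary (shift A) (coordZero A) (n + 1) ⁻¹' {w})))]
    rw [fibreEntropy, ← Finset.sum_neg_distrib]
    refine Finset.sum_congr rfl fun w _ => ?_
    rw [show (fun x : Fin (n + 2) → Fin N => (Fin.init x : Fin (n + 1) → Fin N)) ∘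
      itinerary (shift A) (coordZero A) (n + 2) = itinerary (shift A) (coordZero A) (n + 1) from
      rfl, Real.negMulLog]
    ring
  rw [e2]
  ring

theorem fibreEntropy_itinerary_eq_sum (n : ℕ) :
    fibreEntropy ν (itinerary (shift A) (coordZero A) n) =
      ∑ x : Fin n → Fin N, Real.negMulLog (ν.real (cylinder (sft A) 0 x)) := by
  simp_rw [← itinerary_coordZero_preimage]
  rfl

/-- The increments of the entropy are at most the logarithm of the Perron value. -/
theorem fibreEntropy_increment_le [IsProbabilityMeasure ν]
    (hν : MeasurePreserving (shift A) ν ν) (hA : ∀ i j, A i j = 0 ∨ A i j = 1)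
    (h : IsPositiveEigenTriple A t u v) (n : ℕ) :
    fibreEntropy ν (itinerary (shift A) (coordZero A) (n + 2)) -
      fibreEntropy ν (itinerary (shift A) (coordZero A) (n + 1)) ≤ Real.log t := by
  have hA0 : ∀ i j, 0 ≤ A i j := fun i j => by rcases hA i j with h | h <;> simp [h]
  have := sum_negMulLog_le (fun x : Fin (n + 2) → Fin N => ν.real (cylinder (sft A) 0 x))
    (continuedMass ν t v) (fun x => measureReal_nonneg) (continuedMass_nonneg hA0 h)
    (measureReal_cylinder_eq_zero h) (by rw [sum_continuedMass h, sum_measureReal_cylinder])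
  rw [neg_sum_mul_log_continuedMass hν hA h, ← fibreEntropy_itinerary_eq_sum] at this
  linarith

/-- The equality case of Gibbs' inequality. -/
theorem measureReal_cylinder_of_increment [IsProbabilityMeasure ν]
    (hν : MeasurePreserving (shift A) ν ν) (hA : ∀ i j, A i j = 0 ∨ A i j = 1)
    (h : IsPositiveEigenTriple A t u v) (n : ℕ)
    (hinc : Real.log t ≤ fibreEntropy ν (itinerary (shift A) (coordZero A) (n + 2)) -
      fibreEntropy ν (itinerary (shift A) (coordZero A) (n + 1))) (x : Fin (n + 2) → Fin N) :
    ν.real (cylinder (sft A) 0 x) = continuedMass ν t v x := by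
  have hA0 : ∀ i j, 0 ≤ A i j := fun i j => by rcases hA i j with h | h <;> simp [h]
  by_contra hne
  have := sum_negMulLog_lt (fun x : Fin (n + 2) → Fin N => ν.real (cylinder (sft A) 0 x))
    (continuedMass ν t v) (fun x => measureReal_nonneg) (continuedMass_nonneg hA0 h)
    (measureReal_cylinder_eq_zero h) (by rw [sum_continuedMass h, sum_measureReal_cylinder])
    (fun heq => hne (congrFun heq x))
  rw [neg_sum_mul_log_continuedMass hν hA h, ← fibreEntropy_itinerary_eq_sum] at this
  linarith

/-- An invariant measure with the Parry transition probabilities has the Parry cylinder masses. -/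
theorem measureReal_cylinder_eq_parryWeight [IsProbabilityMeasure ν]
    (hν : MeasurePreserving (shift A) ν ν) (hirr : A.IsIrreducible)
    (h : IsPositiveEigenTriple A t u v)
    (hmark : ∀ (n : ℕ) (x : Fin (n + 2) → Fin N),
      ν.real (cylinder (sft A) 0 x) = continuedMass ν t v x)
    {n : ℕ} (w : Fin (n + 1) → Fin N) (α : ℤ) :
    ν.real (cylinder (sft A) α w) = parryWeight A t u v w := by
  have ht := h.pos.ne'
  have hv := fun i => (h.right_pos i).ne'
  have : Nonempty (Fin N) := ⟨w 0⟩
  set m : Fin N → ℝ := fun a => ν.real (coordZero A ⁻¹' {a}) with hm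
  have hm0 : ∀ a, ν.real (cylinder (sft A) 0 fun _ : Fin 1 => a) = m a := by
    intro a
    simp only [hm]
    congr 1
    ext x
    simp [cylinder, coordZero]
  -- Iterating the one-letter continuation telescopes the quotients of entries of `v`.
  have hform : ∀ (n : ℕ) (w : Fin (n + 1) → Fin N), ν.real (cylinder (sft A) 0 w) =
      m (w 0) / v (w 0) * v (w (Fin.last n)) / t ^ n * pathWeight A w := by
    intro n
    induction n with
    | zero =>
      intro w
      have : w = fun _ => w 0 := by
        ext j
        rw [show j = 0 from Fin.ext (by omega)]
      rw [this, hm0]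
      have := hv (w 0)
      simp only [pathWeight, Finset.univ_eq_empty, Finset.prod_empty, pow_zero]
      field_simp
    | succ n ih =>
      intro w
      rw [hmark, continuedMass, ih, parryMatrix, Matrix.of_apply]
      conv_rhs => rw [← Fin.snoc_init_self w, pathWeight_snoc]
      rw [Fin.snoc_init_self w]
      have h1 := hv (w 0)
      have h2 := hv (w (Fin.last n).castSucc)
      simp only [Fin.init, Fin.castSucc_zero]
      field_simp
      ring
  -- Invariance computes the mass of the letter `b` from the two-letter words ending in `b`. So `m /
  -- v` is a left eigenvector for `t`, a multiple of `u`, and the total mass `1` fixes the factor.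
  have hstat : ∀ b, ∑ i, m i / v i * A i b = t * (m b / v b) := by
    intro b
    have h1 : ∑ x : Fin 2 → Fin N, ν.real (cylinder (sft A) 0 x) * (if x 1 = b then 1 else 0) =
        m b := by
      rw [sum_cylinder_mul_letter hν (1 : Fin 2) fun a => if a = b then 1 else 0]
      simp [hm]
    rw [sum_snoc] at h1
    have h2 : ∀ (w : Fin 1 → Fin N) (a : Fin N),
        (Fin.snoc (α := fun _ => Fin N) w a : Fin 2 → Fin N) 1 = a := fun w a =>
      Fin.snoc_last (α := fun _ => Fin N) a w
    simp only [h2, mul_ite, mul_one, mul_zero, Finset.sum_ite_eq', Finset.mem_univ, if_true] at h1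
    rw [← (Equiv.funUnique (Fin 1) (Fin N)).symm.sum_comp] at h1
    have h3 : ∀ i, ν.real (cylinder (sft A) 0 (Fin.snoc (α := fun _ => Fin N)
        ((Equiv.funUnique (Fin 1) (Fin N)).symm i) b : Fin 2 → Fin N)) =
        m i / v i * A i b * (v b / t) := by
      intro i
      rw [hform, pathWeight_snoc, Fin.snoc_last]
      have : (Fin.snoc (α := fun _ => Fin N)
        ((Equiv.funUnique (Fin 1) (Fin N)).symm i) b : Fin 2 → Fin N) 0 = i := rfl
      rw [this]
      simp [pathWeight]
      ring
    simp only [h3] at h1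
    rw [← Finset.sum_mul] at h1
    have := hv b
    rw [← h1]
    field_simp
  obtain ⟨c, hc⟩ := eigenvector_unique hirr.transpose h.left_pos h.transpose.right_eq
    (y := fun i => m i / v i) (by
      rw [Matrix.mulVec_transpose]
      ext b
      exact hstat b)
  have hmc : ∀ i, m i / v i = c * u i := fun i => congrFun hc i
  have hc1 : c = 1 := by
    have h1 : ∑ i, m i = 1 := by
      rw [hm, sum_measureReal_fibre measurable_coordZero]
      simp
    have h2 : ∑ i, m i = c * ∑ i, u i * v i := by
      rw [Finset.mul_sum]
      refine Finset.sum_congr rfl fun i _ => ?_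
      rw [← mul_assoc, ← hmc, div_mul_cancel₀ _ (hv i)]
    rw [h1, show ∑ i, u i * v i = 1 from h.dot_eq, mul_one] at h2
    exact h2.symm
  rw [measureReal_cylinder_eq hν, hform, hmc, hc1, one_mul, parryWeight]

/-- Bounding blocks of length `k` by those of length `n + k` spares a case distinction between `k`
and `n`. -/
theorem fibreEntropy_itinerary_le_add [IsProbabilityMeasure ν]
    (hν : MeasurePreserving (shift A) ν ν) {n : ℕ} {d : ℝ}
    (hinc : fibreEntropy ν (itinerary (shift A) (coordZero A) (n + 1)) -
      fibreEntropy ν (itinerary (shift A) (coordZero A) n) ≤ d) (k : ℕ) :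
    fibreEntropy ν (itinerary (shift A) (coordZero A) k) ≤
      k * d + fibreEntropy ν (itinerary (shift A) (coordZero A) n) := by
  have h1 := fibreEntropy_itinerary_le_of_increment_le (m := ν) hν measurable_coordZero hinc k
  have h2 : fibreEntropy ν (itinerary (shift A) (coordZero A) k) ≤
      fibreEntropy ν (itinerary (shift A) (coordZero A) (n + k)) :=
    fibreEntropy_comp_le (measurable_itinerary measurable_shift measurable_coordZero (n + k))
      (fun (x : Fin (n + k) → Fin N) (j : Fin k) => x ⟨j, by omega⟩)
  linarith

/-- The block entropies of every invariant measure but the Parry measure grow at a smaller rate than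
the logarithm of the Perron value. -/
theorem exists_lt_fibreEntropy_le [IsProbabilityMeasure ν]
    (hν : MeasurePreserving (shift A) ν ν) (hA : ∀ i j, A i j = 0 ∨ A i j = 1)
    (hirr : A.IsIrreducible) (h : IsPositiveEigenTriple A t u v)
    {μ : Measure (sft A)} [IsProbabilityMeasure μ]
    (hμ : ∀ (n : ℕ) (w : Fin (n + 1) → Fin N) (α : ℤ),
      μ.real (cylinder (sft A) α w) = parryWeight A t u v w) (hne : ν ≠ μ) :
    ∃ d < Real.log t, ∃ C, ∀ n : ℕ,
      fibreEntropy ν (itinerary (shift A) (coordZero A) n) ≤ n * d + C := by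
  by_contra! hcon
  refine hne (measure_ext_cylinder fun n w α => ?_)
  rw [hμ]
  refine measureReal_cylinder_eq_parryWeight hν hirr h (fun n x => ?_) w α
  refine measureReal_cylinder_of_increment hν hA h n ?_ x
  by_contra! hlt
  -- The small increment itself serves as the rate `d`.
  obtain ⟨k, hk⟩ := hcon _ hlt (fibreEntropy ν (itinerary (shift A) (coordZero A) (n + 1)))
  exact hk.not_ge (fibreEntropy_itinerary_le_add hν le_rfl k)

end Uniqueness

/-! ### Properties of the Parry measure -/

section Parry

variable {N : ℕ} {A : Matrix (Fin N) (Fin N) ℝ} {t : ℝ} {u v : Fin N → ℝ} {μ : Measure (sft A)}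
  [IsProbabilityMeasure μ]

theorem measurePreserving_of_parryWeight
    (hμ : ∀ (n : ℕ) (w : Fin (n + 1) → Fin N) (α : ℤ),
      μ.real (cylinder (sft A) α w) = parryWeight A t u v w) : MeasurePreserving (shift A) μ μ := by
  refine ⟨measurable_shift, ?_⟩
  have : IsProbabilityMeasure (μ.map (shift A)) :=
    Measure.isProbabilityMeasure_map measurable_shift.aemeasurable
  refine measure_ext_cylinder fun n w α => ?_
  rw [map_measureReal_apply measurable_shift (measurableSet_cylinder α w)]
  have := shift_iterate_preimage_cylinder (A := A) 1 α w
  rw [Function.iterate_one] at this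
  rw [this, hμ, hμ]

/-- Every word of length `n + 1` has mass at most `K / t ^ n`, so its information is at least `n *
log t - log K`; the entropy is the mean information. -/
theorem exists_le_fibreEntropy (hA : ∀ i j, A i j = 0 ∨ A i j = 1)
    (h : IsPositiveEigenTriple A t u v)
    (hμ : ∀ (n : ℕ) (w : Fin (n + 1) → Fin N) (α : ℤ),
      μ.real (cylinder (sft A) α w) = parryWeight A t u v w) :
    ∃ C, ∀ n : ℕ, n * Real.log t - C ≤ fibreEntropy μ (itinerary (shift A) (coordZero A) n) := by
  obtain ⟨y⟩ : Nonempty (sft A) := μ.nonempty_of_neZero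
  have : Nonempty (Fin N) := ⟨y.1 0⟩
  obtain ⟨q, hq⟩ := Finite.exists_max fun q : Fin N × Fin N => u q.1 * v q.2
  set K := u q.1 * v q.2 with hK
  have hK0 : 0 < K := mul_pos (h.left_pos _) (h.right_pos _)
  have hsucc : ∀ n : ℕ, n * Real.log t - Real.log K ≤
      fibreEntropy μ (itinerary (shift A) (coordZero A) (n + 1)) := by
    intro n
    have key : ∀ x : Fin (n + 1) → Fin N, μ.real (cylinder (sft A) 0 x) *
        (n * Real.log t - Real.log K) ≤ Real.negMulLog (μ.real (cylinder (sft A) 0 x)) := by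
      intro x
      rcases (measureReal_nonneg (μ := μ) (s := cylinder (sft A) 0 x)).eq_or_lt with h0 | h0
      · simp [← h0]
      have hle : μ.real (cylinder (sft A) 0 x) ≤ K / t ^ n := by
        rw [hμ, parryWeight]
        have h1 : u (x 0) * v (x (Fin.last n)) ≤ K := hq (x 0, x (Fin.last n))
        have h2 : 0 ≤ u (x 0) * v (x (Fin.last n)) / t ^ n :=
          div_nonneg (mul_pos (h.left_pos _) (h.right_pos _)).le (pow_pos h.pos n).le
        have h3 : pathWeight A x ≤ 1 := by
          rcases pathWeight_eq_zero_or_one hA x with h | h <;> simp [h]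
        calc _ ≤ u (x 0) * v (x (Fin.last n)) / t ^ n := mul_le_of_le_one_right h2 h3
          _ ≤ _ := div_le_div_of_nonneg_right h1 (pow_pos h.pos n).le
      have hlog := Real.log_le_log h0 hle
      rw [Real.log_div hK0.ne' (pow_pos h.pos n).ne', Real.log_pow] at hlog
      rw [Real.negMulLog, neg_mul_comm]
      exact mul_le_mul_of_nonneg_left (by linarith) h0.le
    have := Finset.sum_le_sum fun x (_ : x ∈ Finset.univ) => key x
    rwa [← Finset.sum_mul, sum_measureReal_cylinder, one_mul,
      ← fibreEntropy_itinerary_eq_sum] at this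
  refine ⟨|Real.log t| + |Real.log K|, fun n => ?_⟩
  cases n with
  | zero =>
    have : 0 ≤ fibreEntropy μ (itinerary (shift A) (coordZero A) 0) :=
      Finset.sum_nonneg fun a _ => Real.negMulLog_nonneg measureReal_nonneg measureReal_le_one
    simp only [Nat.cast_zero, zero_mul]
    have := abs_nonneg (Real.log t)
    have := abs_nonneg (Real.log K)
    linarith
  | succ n =>
    have h1 := hsucc n
    have h2 := le_abs_self (Real.log t)
    have h3 := le_abs_self (Real.log K)
    push_cast
    linarith

theorem exists_fibreEntropy_le (hA : ∀ i j, A i j = 0 ∨ A i j = 1)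
    (h : IsPositiveEigenTriple A t u v) (hμ : MeasurePreserving (shift A) μ μ) :
    ∃ C, ∀ n : ℕ, fibreEntropy μ (itinerary (shift A) (coordZero A) n) ≤ n * Real.log t + C :=
  ⟨_, fibreEntropy_itinerary_le_add hμ (fibreEntropy_increment_le hμ hA h 0)⟩

theorem measureEntropy_eq_log (hA : ∀ i j, A i j = 0 ∨ A i j = 1)
    (h : IsPositiveEigenTriple A t u v)
    (hμ : ∀ (n : ℕ) (w : Fin (n + 1) → Fin N) (α : ℤ),
      μ.real (cylinder (sft A) α w) = parryWeight A t u v w) :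
    measureEntropy (shift A) μ = (Real.log t : EReal) := by
  have hinv := measurePreserving_of_parryWeight hμ
  obtain ⟨C, hC⟩ := exists_fibreEntropy_le hA h hinv
  obtain ⟨C', hC'⟩ := exists_le_fibreEntropy hA h hμ
  exact le_antisymm (measureEntropy_le hinv hC) (le_measureEntropy hC')

theorem fibreEntropy_smul {X α : Type*} [MeasurableSpace X] [Fintype α] [MeasurableSpace α]
    [MeasurableSingletonClass α] {m m' : Measure X} [IsProbabilityMeasure m] {F : X → α}
    (hF : Measurable F) {a : ℝ} (hm' : ∀ s, m'.real s = a * m.real s) :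
    fibreEntropy m' F = a * fibreEntropy m F + Real.negMulLog a := by
  have h1 := sum_measureReal_fibre (m := m) hF
  rw [probReal_univ] at h1
  simp only [fibreEntropy, hm', Real.negMulLog_mul, Finset.sum_add_distrib]
  rw [← Finset.sum_mul, ← Finset.mul_sum, h1]
  ring

/-- A nontrivial invariant set would split `μ` into its conditional measures on the set and on the
complement. Neither equals `μ`, so their block entropies grow at rates below `log t`. Mixing adds
only the constants `negMulLog a` and `negMulLog b`, which contradicts `exists_le_fibreEntropy`. -/
theorem ergodic_of_parryWeight (hA : ∀ i j, A i j = 0 ∨ A i j = 1)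
    (hirr : A.IsIrreducible) (h : IsPositiveEigenTriple A t u v)
    (hμ : ∀ (n : ℕ) (w : Fin (n + 1) → Fin N) (α : ℤ),
      μ.real (cylinder (sft A) α w) = parryWeight A t u v w) : Ergodic (shift A) μ := by
  have hinv := measurePreserving_of_parryWeight hμ
  refine ⟨hinv, ⟨fun s hs hpre => ?_⟩⟩
  rw [Filter.eventuallyConst_set']
  by_contra! hcon
  have hs0 : μ s ≠ 0 := fun h0 => hcon.1 (ae_eq_empty.2 h0)
  have hs1 : μ sᶜ ≠ 0 := fun h0 => hcon.2 (ae_eq_univ.2 h0)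
  have cond_inv : ∀ s, MeasurableSet s → shift A ⁻¹' s = s →
      MeasurePreserving (shift A) (ProbabilityTheory.cond μ s) (ProbabilityTheory.cond μ s) := by
    intro s hs hpre
    have := hinv.restrict_preimage hs
    rw [hpre] at this
    exact this.smul_measure _
  have growth : ∀ s, MeasurableSet s → shift A ⁻¹' s = s → μ s ≠ 0 → μ sᶜ ≠ 0 →
      ∃ d < Real.log t, ∃ C, ∀ n : ℕ,
        fibreEntropy (ProbabilityTheory.cond μ s) (itinerary (shift A) (coordZero A) n) ≤
          n * d + C := by
    intro s hs hpre h0 h1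
    have := ProbabilityTheory.cond_isProbabilityMeasure h0
    -- The conditional measure on `s` gives the complement mass zero, unlike `μ`.
    refine exists_lt_fibreEntropy_le (cond_inv s hs hpre) hA hirr h hμ fun heq => h1 ?_
    rw [← heq, ProbabilityTheory.cond_apply hs]
    simp
  obtain ⟨d₁, hd₁, C₁, hC₁⟩ := growth s hs hpre hs0 hs1
  obtain ⟨d₂, hd₂, C₂, hC₂⟩ := growth sᶜ hs.compl (by rw [Set.preimage_compl, hpre]) hs1
    (by rwa [compl_compl])
  obtain ⟨C, hC⟩ := exists_le_fibreEntropy hA h hμ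
  have := ProbabilityTheory.cond_isProbabilityMeasure hs0
  have := ProbabilityTheory.cond_isProbabilityMeasure hs1
  set a := μ.real s with ha
  set b := μ.real sᶜ with hb
  have ha0 : 0 ≤ a := measureReal_nonneg
  have hb0 : 0 ≤ b := measureReal_nonneg
  have hab : a + b = 1 := by rw [ha, hb, measureReal_add_measureReal_compl hs]; simp
  have hres : ∀ s, MeasurableSet s → μ s ≠ 0 → ∀ r,
      (μ.restrict s).real r = μ.real s * (ProbabilityTheory.cond μ s).real r := by
    intro s hs h0 r
    have h1 : μ.real s ≠ 0 := (measureReal_ne_zero_iff).2 h0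
    rw [ProbabilityTheory.cond, measureReal_ennreal_smul_apply, ENNReal.toReal_inv,
      ← measureReal_def, mul_inv_cancel_left₀ h1]
  set d := max d₁ d₂ with hd
  have hdlt : d < Real.log t := max_lt hd₁ hd₂
  have hbound : ∀ n : ℕ, n * (Real.log t - d) ≤
      C + (a * C₁ + Real.negMulLog a) + (b * C₂ + Real.negMulLog b) := by
    intro n
    have mF := measurable_itinerary (T := shift A) measurable_shift measurable_coordZero n
    have e1 := fibreEntropy_le_add (m := μ) (m₁ := μ.restrict s) (m₂ := μ.restrict sᶜ)
      (itinerary (shift A) (coordZero A) n) fun w => by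
        rw [measureReal_restrict_apply (mF (measurableSet_singleton w)),
          measureReal_restrict_apply (mF (measurableSet_singleton w)), ← Set.sdiff_eq,
          measureReal_inter_add_sdiff hs]
    rw [fibreEntropy_smul mF (hres s hs hs0), fibreEntropy_smul mF (hres sᶜ hs.compl hs1)] at e1
    have hn : (0 : ℝ) ≤ n := n.cast_nonneg
    have e2 : fibreEntropy (ProbabilityTheory.cond μ s) (itinerary (shift A) (coordZero A) n) ≤
        n * d + C₁ := (hC₁ n).trans (by gcongr; exact le_max_left _ _)
    have e3 : fibreEntropy (ProbabilityTheory.cond μ sᶜ) (itinerary (shift A) (coordZero A) n) ≤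
        n * d + C₂ := (hC₂ n).trans (by gcongr; exact le_max_right _ _)
    have e4 := mul_le_mul_of_nonneg_left e2 ha0
    have e5 := mul_le_mul_of_nonneg_left e3 hb0
    have e6 : a * (n * d) + b * (n * d) = n * d := by rw [← add_mul, hab, one_mul]
    linarith [hC n]
  obtain ⟨n, hn⟩ := Archimedean.arch
    (C + (a * C₁ + Real.negMulLog a) + (b * C₂ + Real.negMulLog b) + 1) (sub_pos.2 hdlt)
  rw [nsmul_eq_mul] at hn
  linarith [hbound n]

end Parry

/-! ### Counting words -/

section Words

variable {N : ℕ} {A : Matrix (Fin N) (Fin N) ℝ} {t : ℝ} {u v : Fin N → ℝ} {μ : Measure (sft A)}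
  [IsProbabilityMeasure μ]

theorem pathWeight_of_mem_words {n : ℕ} {x : Fin (n + 1) → Fin N}
    (hx : x ∈ words (sft A) (n + 1)) : pathWeight A x = 1 := by
  obtain ⟨α, y, hy⟩ := hx
  refine Finset.prod_eq_one fun i _ => ?_
  have h1 := hy i.castSucc
  have h2 := hy i.succ
  have h3 := y.2 (α + (i : ℕ))
  rw [Fin.val_castSucc] at h1
  rw [h1, show α + ((i : ℕ) : ℤ) + 1 = α + ((i.succ : ℕ) : ℤ) by
    rw [Fin.val_succ]; push_cast; ring, h2] at h3
  exact h3

/-- A path allowed by `A` extends to a bi-infinite point because its cylinder has positive Parry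
mass. -/
theorem mem_words_iff (h : IsPositiveEigenTriple A t u v)
    (hμ : ∀ (n : ℕ) (w : Fin (n + 1) → Fin N) (α : ℤ),
      μ.real (cylinder (sft A) α w) = parryWeight A t u v w) {n : ℕ} (x : Fin (n + 1) → Fin N) :
    x ∈ words (sft A) (n + 1) ↔ pathWeight A x ≠ 0 := by
  refine ⟨fun hx => by simp [pathWeight_of_mem_words hx], fun hx => ⟨0, ?_⟩⟩
  refine nonempty_of_measureReal_ne_zero (μ := μ) ?_
  rw [hμ]
  exact mul_ne_zero (div_ne_zero (mul_ne_zero (h.left_pos _).ne' (h.right_pos _).ne')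
    (pow_ne_zero _ h.pos.ne')) hx

open Classical in
theorem ncard_words_hasWindow (hA : ∀ i j, A i j = 0 ∨ A i j = 1)
    (h : IsPositiveEigenTriple A t u v)
    (hμ : ∀ (n : ℕ) (w : Fin (n + 1) → Fin N) (α : ℤ),
      μ.real (cylinder (sft A) α w) = parryWeight A t u v w) {m k n : ℕ} (w : Fin n → Fin N) :
    ((({x | x ∈ words (sft A) (m + 1) ∧ HasWindow k w x} :
      Set (Fin (m + 1) → Fin N)).ncard : ℕ) : ℝ) =
      ∑ x : Fin (m + 1) → Fin N with HasWindow k w x, pathWeight A x := by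
  have e : ({x | x ∈ words (sft A) (m + 1) ∧ HasWindow k w x} : Set (Fin (m + 1) → Fin N)) =
      ↑(Finset.univ.filter fun x : Fin (m + 1) → Fin N => HasWindow k w x ∧ pathWeight A x ≠ 0) := by
    ext x
    simp [mem_words_iff h hμ, and_comm]
  rw [e, Set.ncard_coe_finset, ← Finset.filter_filter, ← Finset.sum_filter_ne_zero,
    Finset.card_eq_sum_ones, Nat.cast_sum]
  refine Finset.sum_congr rfl fun x hx => ?_
  rw [(pathWeight_eq_zero_or_one hA x).resolve_left (Finset.mem_filter.1 hx).2, Nat.cast_one]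

theorem ncard_words (hA : ∀ i j, A i j = 0 ∨ A i j = 1) (h : IsPositiveEigenTriple A t u v)
    (hμ : ∀ (n : ℕ) (w : Fin (n + 1) → Fin N) (α : ℤ),
      μ.real (cylinder (sft A) α w) = parryWeight A t u v w) {m m' : ℕ} (hm : m' = m + 1) :
    ((words (sft A) m').ncard : ℝ) = ∑ i, rowSum A m i := by
  classical
  subst hm
  have hw : ∀ x : Fin (m + 1) → Fin N, HasWindow 0 (Fin.elim0 : Fin 0 → Fin N) x :=
    fun x j => j.elim0
  have := ncard_words_hasWindow hA h hμ (m := m) (k := 0) (Fin.elim0 : Fin 0 → Fin N)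
  simp only [hw, and_true, Finset.filter_true] at this
  rw [← sum_pathWeight, ← this]
  rfl

theorem ncard_finiteCylinder (hA : ∀ i j, A i j = 0 ∨ A i j = 1)
    (h : IsPositiveEigenTriple A t u v)
    (hμ : ∀ (n : ℕ) (w : Fin (n + 1) → Fin N) (α : ℤ),
      μ.real (cylinder (sft A) α w) = parryWeight A t u v w) {n : ℕ} (k l : ℕ)
    (w : Fin (n + 1) → Fin N) :
    ((finiteCylinder (sft A) k l w).ncard : ℝ) =
      rowSum A.transpose k (w 0) * pathWeight A w * rowSum A l (w (Fin.last n)) := by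
  classical
  -- The length is a variable because `n + 1 + k + l` and `n + k + l + 1` give different types of
  -- words.
  have key : ∀ m', m' = n + k + l + 1 →
      ((({x | x ∈ words (sft A) m' ∧ HasWindow k w x} : Set (Fin m' → Fin N)).ncard : ℕ) : ℝ) =
        rowSum A.transpose k (w 0) * pathWeight A w * rowSum A l (w (Fin.last n)) := by
    rintro _ rfl
    rw [ncard_words_hasWindow hA h hμ, ← vecMul_pow_one, ← pow_mulVec_one,
      ← sum_paths_hasWindow 1 1 (n + k + l) k l n w rfl]
    simp
  rw [← key (n + 1 + k + l) (by ring)]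
  congr 2
  ext x
  simp only [finiteCylinder, Set.mem_ofPred_eq, HasWindow]
  exact and_congr_right fun _ => ⟨fun hx j _ => hx j, fun hx j => hx j (by omega)⟩

/-- The topological entropy is the logarithm of the Perron value. -/
theorem topEntropy_eq_log [NeZero N] (hA : ∀ i j, A i j = 0 ∨ A i j = 1)
    (h : IsPositiveEigenTriple A t u v)
    (hμ : ∀ (n : ℕ) (w : Fin (n + 1) → Fin N) (α : ℤ),
      μ.real (cylinder (sft A) α w) = parryWeight A t u v w) :
    topEntropy (sft A) = (Real.log t : EReal) := by
  have hA0 : ∀ i j, 0 ≤ A i j := fun i j => by rcases hA i j with h | h <;> simp [h]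
  obtain ⟨a, b, ha, hb, hab⟩ := h.exists_rowSum_bounds hA0
  -- The first term covers `n = 0`; `|log t|` pays for the shift between words of `n + 1` letters
  -- and paths of `n` steps.
  set C := |Real.log ((words (sft A) 0).ncard : ℝ)| + |Real.log a| + |Real.log b| + |Real.log t|
    with hC
  have b0 := abs_le.1 (le_refl |Real.log ((words (sft A) 0).ncard : ℝ)|)
  have b1 := abs_le.1 (le_refl |Real.log a|)
  have b2 := abs_le.1 (le_refl |Real.log b|)
  have b3 := abs_le.1 (le_refl |Real.log t|)
  have hlog : ∀ n : ℕ, n * Real.log t - C ≤ Real.log ((words (sft A) n).ncard : ℝ) ∧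
      Real.log ((words (sft A) n).ncard : ℝ) ≤ n * Real.log t + C := by
    intro n
    cases n with
    | zero =>
      simp only [Nat.cast_zero, zero_mul]
      constructor <;> linarith
    | succ n =>
      rw [ncard_words hA h hμ rfl]
      obtain ⟨h1, h2⟩ := hab n
      have hp := pow_pos h.pos n
      have l1 := Real.log_le_log (mul_pos ha hp) h1
      have l2 := Real.log_le_log ((mul_pos ha hp).trans_le h1) h2
      rw [Real.log_mul ha.ne' hp.ne', Real.log_pow] at l1
      rw [Real.log_mul hb.ne' hp.ne', Real.log_pow] at l2
      push_cast
      constructor <;> linarith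
  exact le_antisymm (EReal_limsup_div_le fun n => (hlog n).2)
    (le_EReal_limsup_div fun n => (hlog n).1)

end Words

/-! ### Characterizations of the Parry measure -/

section Characterizations

variable {N : ℕ} {A : Matrix (Fin N) (Fin N) ℝ} {t : ℝ} {u v : Fin N → ℝ} {μ : Measure (sft A)}
  [IsProbabilityMeasure μ]

theorem isAveragedNaturalMeasure_of_parryWeight [NeZero N] (hA : ∀ i j, A i j = 0 ∨ A i j = 1)
    (h : IsPositiveEigenTriple A t u v)
    (hμ : ∀ (n : ℕ) (w : Fin (n + 1) → Fin N) (α : ℤ),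
      μ.real (cylinder (sft A) α w) = parryWeight A t u v w)
    {p M : ℕ} [NeZero p] {c : Fin N → ZMod p} (hc : IsCyclic A c M) :
    IsAveragedNaturalMeasure (sft A) p μ := by
  refine ⟨inferInstance, fun n hn w α => ?_⟩
  obtain ⟨n, rfl⟩ := Nat.exists_eq_add_of_le' hn
  have e : ∀ q : ℕ × ℕ, ((words (sft A) (n + 1 + q.1 + q.2)).ncard : ℝ) =
      ∑ i, rowSum A (n + q.1 + q.2) i := fun q => ncard_words hA h hμ (by ring)
  simp_rw [e, ncard_finiteCylinder hA h hμ, hμ, parryWeight]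
  -- For a forbidden word both sides vanish; an allowed one advances the cyclic class by `n`, as
  -- `tendsto_average` requires.
  rcases pathWeight_eq_zero_or_one hA w with hw | hw
  · simp [hw]
  · simp only [hw, mul_one]
    exact h.tendsto_average hc _ _ n (cyclic_class_last hc w (by simp [hw]))

theorem isAveragedNaturalMeasure_iff {X : Set (ℤ → Fin N)} {μ : Measure X} {p : ℕ}
    (hμ : IsAveragedNaturalMeasure X p μ) (ν : Measure X) :
    IsAveragedNaturalMeasure X p ν ↔ ν = μ := by
  refine ⟨fun hν => ?_, fun hν => hν ▸ hμ⟩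
  have := hν.1
  have := hμ.1
  exact measure_ext_cylinder fun n w α =>
    tendsto_nhds_unique (hν.2 (n + 1) (by omega) w α) (hμ.2 (n + 1) (by omega) w α)

theorem isNaturalMeasure_iff_averaged {X : Set (ℤ → Fin N)} {ν : Measure X} :
    IsNaturalMeasure X ν ↔ IsAveragedNaturalMeasure X 1 ν := by
  simp only [IsNaturalMeasure, IsAveragedNaturalMeasure, Finset.sum_range_one, Nat.cast_one,
    div_one, one_mul]
  exact Iff.rfl

theorem isParryMeasure_iff [NeZero N] (hirr : A.IsIrreducible)
    (h : IsPositiveEigenTriple A t u v)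
    (hμ : ∀ (n : ℕ) (w : Fin (n + 1) → Fin N) (α : ℤ),
      μ.real (cylinder (sft A) α w) = parryWeight A t u v w) (ν : Measure (sft A)) :
    IsParryMeasure A ν ↔ ν = μ := by
  have hP := h.isPerronTriple hirr.nonneg
  constructor
  · rintro ⟨hν, -, hcyl⟩
    refine measure_ext_cylinder fun n w α => ?_
    rw [hμ, hcyl t u v hP]
    rfl
  · rintro rfl
    refine ⟨inferInstance, ⟨t, u, v, hP⟩, fun lam U V hT n w α => ?_⟩
    -- The factors `c` and `c⁻¹` cancel in the product of the two end entries.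
    obtain ⟨rfl, c, hc, rfl, rfl⟩ := IsPerronTriple.eq_smul hirr h hT
    rw [hμ, parryWeight, pathWeight]
    simp only [Pi.smul_apply, smul_eq_mul]
    congr 2
    field_simp

theorem isErgodicOfMaximalEntropy_iff [NeZero N] (hA : ∀ i j, A i j = 0 ∨ A i j = 1)
    (hirr : A.IsIrreducible) (h : IsPositiveEigenTriple A t u v)
    (hμ : ∀ (n : ℕ) (w : Fin (n + 1) → Fin N) (α : ℤ),
      μ.real (cylinder (sft A) α w) = parryWeight A t u v w) (ν : Measure (sft A)) :
    IsErgodicOfMaximalEntropy A ν ↔ ν = μ := by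
  have htop := topEntropy_eq_log hA h hμ
  constructor
  · rintro ⟨hν, herg, hent⟩
    by_contra hne
    obtain ⟨d, hd, C, hC⟩ :=
      exists_lt_fibreEntropy_le herg.toMeasurePreserving hA hirr h hμ hne
    have hle := measureEntropy_le herg.toMeasurePreserving hC
    rw [hent, htop, EReal.coe_le_coe_iff] at hle
    exact hd.not_ge hle
  · rintro rfl
    exact ⟨inferInstance, ergodic_of_parryWeight hA hirr h hμ,
      (measureEntropy_eq_log hA h hμ).trans htop.symm⟩

theorem exists_averagedNatural_parry_maximal [NeZero N] (hA : ∀ i j, A i j = 0 ∨ A i j = 1)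
    (hirr : A.IsIrreducible) {p : ℕ} [NeZero p] (hp : HasPeriod A p) :
    ∃ μ : Measure (sft A), (∀ ν, IsAveragedNaturalMeasure (sft A) p ν ↔ ν = μ) ∧
      (∀ ν, IsParryMeasure A ν ↔ ν = μ) ∧ (∀ ν, IsErgodicOfMaximalEntropy A ν ↔ ν = μ) := by
  obtain ⟨t, u, v, h⟩ := exists_isPositiveEigenTriple hirr
  obtain ⟨c, M, hc⟩ := exists_isCyclic hirr 0 (hp 0)
  obtain ⟨μ, hprob, hμ⟩ := h.exists_measure hA
  exact ⟨μ, isAveragedNaturalMeasure_iff (isAveragedNaturalMeasure_of_parryWeight hA h hμ hc),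
    isParryMeasure_iff hirr h hμ, isErgodicOfMaximalEntropy_iff hA hirr h hμ⟩

end Characterizations

end ShiftSpace
end

theorem theorem1p1 (N : ℕ) (hN : 1 ≤ N) (A : Matrix (Fin N) (Fin N) ℝ)
    (hA : ∀ i j, A i j = 0 ∨ A i j = 1) :
    (A.IsPrimitive →
      ∃ μ : Measure (ShiftSpace.sft A),
        (∀ ν, ShiftSpace.IsNaturalMeasure (ShiftSpace.sft A) ν ↔ ν = μ) ∧
        (∀ ν, ShiftSpace.IsParryMeasure A ν ↔ ν = μ) ∧
        (∀ ν, ShiftSpace.IsErgodicOfMaximalEntropy A ν ↔ ν = μ)) ∧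
    (∀ p : ℕ, 2 ≤ p → A.IsIrreducible → ShiftSpace.HasPeriod A p →
      ∃ μ : Measure (ShiftSpace.sft A),
        (∀ ν, ShiftSpace.IsAveragedNaturalMeasure (ShiftSpace.sft A) p ν ↔ ν = μ) ∧
        (∀ ν, ShiftSpace.IsParryMeasure A ν ↔ ν = μ) ∧
        (∀ ν, ShiftSpace.IsErgodicOfMaximalEntropy A ν ↔ ν = μ)) := by
  have : NeZero N := ⟨by omega⟩
  constructor
  · intro hprim
    -- Primitive matrices have period `1`, and the average over one position is the plain ratio.
    obtain ⟨μ, h1, h2, h3⟩ := ShiftSpace.exists_averagedNatural_parry_maximal hA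
      hprim.isIrreducible (p := 1) (ShiftSpace.setGcd_eq_one_of_isPrimitive hprim)
    exact ⟨μ, fun ν => ShiftSpace.isNaturalMeasure_iff_averaged.trans (h1 ν), h2, h3⟩
  · intro p hp hirr hper
    have : NeZero p := ⟨by omega⟩
    exact ShiftSpace.exists_averagedNatural_parry_maximal hA hirr hper
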